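/- Let $\mathfrak h$ be a finite-dimensional complex Lie algebra and let $\theta\colon \mathfrak{sl}_2(\mathbb C)\to\mathfrak{gl}(V)$ be a representation on a finite-dimensional complex vector space $V\neq 0$. Let $A=\mathcal C\mathfrak h=(\bigwedge^\bullet\mathfrak h^*,d)$ be the Chevalley–Eilenberg commutative differential graded algebra of $\mathfrak h$, and $H^i(\mathfrak h)=H^i(A)$. Let $$\mathcal F(A,\mathfrak{sl}_2)=\{\omega\in A^1\otimes\mathfrak{sl}_2 \mid d\omega+\tfrac12[\omega,\omega]=0\}$$ be the variety of $\mathfrak{sl}_2$-valued flat connections. For $\omega\in\mathcal F(A,\mathfrak{sl}_2)$ let $d_\omega=d\otimes\mathrm{id}+\omega\,\cdot$ be the covariant derivative on $A^\bullet\otimes V$, where $(\eta\otimes g)\cdot(a\otimes v)=\eta a\otimes\theta(g)v$, and for $i\ge 0$ put $$\mathcal R^i_1(A,\theta)=\{\omega\in\mathcal F(A,\mathfrak{sl}_2)\mid \dim H^i(A\otimes V,d_\omega)\ge 1\}.$$ Since $A^0=\mathbb C\cdot 1$, $H^1(\mathfrak h)=\{\eta\in A^1\mid d\eta=0\}$ is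 a subspace of $A^1$, so that $H^1(\mathfrak h)\otimes\mathfrak{sl}_2\subseteq A^1\otimes\mathfrak{sl}_2$. For subsets $S\subseteq\mathbb P(H^1(\mathfrak h))$ and $T\subseteq\mathbb P(\mathfrak{sl}_2)$, let $\mathrm{cone}(S\times T)\subseteq H^1(\mathfrak h)\otimes\mathfrak{sl}_2$ be the affine cone over the image of $S\times T$ under the Segre embedding, that is, $\{0\}\cup\{\eta\otimes g \mid [\eta]\in S,\ [g]\in T\}$. Let $V(\det\circ\theta)=\{[g]\in\mathbb P(\mathfrak{sl}_2)\mid \det\theta(g)=0\}$. A subscript $(0)$ denotes the (reduced) analytic germ at $0$, i.e. the germ at $0$ of the underlying set. (1) If $H^1(\mathfrak h)=0$, then $\mathcal F(A,\mathfrak{sl}_2)_{(0)}=\{0\}$ and, for every $i\ge 0$, $\mathcal R^i_1(A,\theta)_{(0)}$ is empty if $H^i(\mathfrak h)=0$ and equals $\{0\}$ if $H^i(\mathfrak h)\ne 0$. (2) If $H^1(\mathfrak h)\neq 0$, then $\mathcal F(A,\mathfrak{sl}_2)_{(0)}$ is analytically isomorphic to, and in fact as a germ in $A^1\otimes\mathfrak{sl}_2$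 equal to, $\mathrm{cone}(\mathbb P(H^1(\mathfrak h))\times\mathbb P(\mathfrak{sl}_2))_{(0)}$; and, for every $i\ge 0$, as germs in $A^1\otimes\mathfrak{sl}_2$, $$\mathcal R^i_1(A,\theta)_{(0)}=\begin{cases}\emptyset & \text{if } H^i(\mathfrak h)=0,\\ \mathrm{cone}(\mathbb P(H^1(\mathfrak h))\times V(\det\circ\theta))_{(0)} & \text{if } H^i(\mathfrak h)\ne 0.\end{cases}$$ -/

import Mathlib

open scoped TensorProduct LinearAlgebra.Projectivization

-- the commutator bracket on endomorphism algebras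
attribute [local instance 100] LieRing.ofAssociativeRing

noncomputable section

/-! ### Cohomology of a sequence of linear maps -/

/-- The coboundaries in degree `i` of `C 0 → C 1 → C 2 → ⋯`. -/
def coboundaries {C : ℕ → Type*} [∀ i, AddCommGroup (C i)] [∀ i, Module ℂ (C i)]
    (δ : ∀ i, C i →ₗ[ℂ] C (i + 1)) : ∀ i, Submodule ℂ (C i)
  | 0 => ⊥
  | i + 1 => LinearMap.range (δ i)

/-- The cohomology space `ker δⁱ / im δⁱ⁻¹` in degree `i` (it is used for `δ ∘ δ = 0` only, where
`im δⁱ⁻¹ ⊆ ker δⁱ`). -/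
abbrev cochainCohomology {C : ℕ → Type*} [∀ i, AddCommGroup (C i)] [∀ i, Module ℂ (C i)]
    (δ : ∀ i, C i →ₗ[ℂ] C (i + 1)) (i : ℕ) : Type _ :=
  LinearMap.ker (δ i) ⧸ (coboundaries δ i).submoduleOf (LinearMap.ker (δ i))

/-! ### Commutative differential graded algebras, flat connections, resonance -/

/-- A complex commutative differential graded algebra structure (differential of degree `+1`,
graded-commutative product) on a graded algebra with homogeneous components `𝒜 i`. -/
structure CDGA {A : Type*} [Ring A] [Algebra ℂ A] (𝒜 : ℕ → Submodule ℂ A) [GradedAlgebra 𝒜] where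
  d : A →ₗ[ℂ] A
  d_mem : ∀ {i : ℕ} {a : A}, a ∈ 𝒜 i → d a ∈ 𝒜 (i + 1)
  d_d : ∀ a : A, d (d a) = 0
  leibniz : ∀ {i : ℕ} {a : A}, a ∈ 𝒜 i → ∀ b : A, d (a * b) = d a * b + (-1 : ℂ) ^ i • (a * d b)
  graded_comm : ∀ {i j : ℕ} {a b : A}, a ∈ 𝒜 i → b ∈ 𝒜 j →
    a * b = (-1 : ℂ) ^ (i * j) • (b * a)

namespace CDGA

variable {A : Type*} [Ring A] [Algebra ℂ A] {𝒜 : ℕ → Submodule ℂ A} [GradedAlgebra 𝒜]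

/-- The differential `d : Aⁱ → Aⁱ⁺¹`. -/
def dDeg (D : CDGA 𝒜) (i : ℕ) : 𝒜 i →ₗ[ℂ] 𝒜 (i + 1) :=
  D.d.restrict fun _ ha => D.d_mem ha

/-- The cohomology `Hⁱ(A)`. -/
abbrev H (D : CDGA 𝒜) (i : ℕ) : Type _ := cochainCohomology D.dDeg i

/-- The algebra is connected: `A⁰ = ℂ · 1`. -/
def IsConnected (_D : CDGA 𝒜) : Prop := 𝒜 0 = Submodule.span ℂ {1}

variable (𝒜) in
/-- The multiplication `A¹ × Aⁱ → Aⁱ⁺¹`, `(η, a) ↦ η a`. -/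
def mulDeg (i : ℕ) : 𝒜 1 →ₗ[ℂ] 𝒜 i →ₗ[ℂ] 𝒜 (i + 1) :=
  LinearMap.mk₂ ℂ
    (fun η a => ⟨(η : A) * (a : A), add_comm 1 i ▸ SetLike.mul_mem_graded η.2 a.2⟩)
    (fun _ _ _ => Subtype.ext (by simp [add_mul]))
    (fun _ _ _ => Subtype.ext (by simp))
    (fun _ _ _ => Subtype.ext (by simp [mul_add]))
    (fun _ _ _ => Subtype.ext (by simp))

variable {𝔤 : Type*} [LieRing 𝔤] [LieAlgebra ℂ 𝔤] {V : Type*} [AddCommGroup V] [Module ℂ V]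

variable (𝒜) in
/-- The bilinear map `(A¹ ⊗ 𝔤) × (Aⁱ ⊗ V) → Aⁱ⁺¹ ⊗ V`, `(η ⊗ g, a ⊗ v) ↦ η a ⊗ θ(g) v`,
given by a representation `θ` of `𝔤` on `V`. -/
def act (θ : 𝔤 →ₗ⁅ℂ⁆ Module.End ℂ V) (i : ℕ) :
    (𝒜 1 ⊗[ℂ] 𝔤) →ₗ[ℂ] (𝒜 i ⊗[ℂ] V) →ₗ[ℂ] (𝒜 (i + 1) ⊗[ℂ] V) :=
  TensorProduct.map₂ (mulDeg 𝒜 i) (θ : 𝔤 →ₗ[ℂ] Module.End ℂ V)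

variable (𝔤) in
/-- The `𝔤`-valued flat connections on `A`: the solutions `ω ∈ A¹ ⊗ 𝔤` of the Maurer–Cartan
equation `dω + ½ [ω, ω] = 0`, where `[η ⊗ g, η' ⊗ g'] = η η' ⊗ [g, g']` (that is, the action
above for the adjoint representation). -/
def flatConnections (D : CDGA 𝒜) : Set (𝒜 1 ⊗[ℂ] 𝔤) :=
  {ω | (D.dDeg 1).rTensor 𝔤 ω + (1 / 2 : ℂ) • act 𝒜 (LieAlgebra.ad ℂ 𝔤) 1 ω ω = 0}

/-- The covariant derivative `d_ω = d ⊗ id + ω · : Aⁱ ⊗ V → Aⁱ⁺¹ ⊗ V`. -/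
def covDeriv (D : CDGA 𝒜) (θ : 𝔤 →ₗ⁅ℂ⁆ Module.End ℂ V) (ω : 𝒜 1 ⊗[ℂ] 𝔤) (i : ℕ) :
    (𝒜 i ⊗[ℂ] V) →ₗ[ℂ] (𝒜 (i + 1) ⊗[ℂ] V) :=
  (D.dDeg i).rTensor V + act 𝒜 θ i ω

/-- The resonance variety `ℛⁱ_r(A, θ)` in degree `i` and depth `r`: the flat connections `ω` with
`dim Hⁱ(A ⊗ V, d_ω) ≥ r`. -/
def resonance (D : CDGA 𝒜) (θ : 𝔤 →ₗ⁅ℂ⁆ Module.End ℂ V) (i r : ℕ) : Set (𝒜 1 ⊗[ℂ] 𝔤) :=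
  {ω | ω ∈ D.flatConnections 𝔤 ∧
    (r : Cardinal) ≤ Module.rank ℂ (cochainCohomology (D.covDeriv θ ω) i)}

theorem d_one (D : CDGA 𝒜) : D.d 1 = 0 := by
  have h := D.leibniz (i := 0) (a := (1 : A)) SetLike.GradedOne.one_mem 1
  simpa using h

theorem coboundaries_one_of_isConnected (D : CDGA 𝒜) (hD : D.IsConnected) :
    coboundaries D.dDeg 1 = ⊥ := by
  refine LinearMap.range_eq_bot.mpr (LinearMap.ext fun a => Subtype.ext ?_)
  have ha : (a : A) ∈ Submodule.span ℂ {(1 : A)} := hD ▸ a.2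
  obtain ⟨c, hc⟩ := Submodule.mem_span_singleton.mp ha
  change D.d (a : A) = 0
  rw [← hc, map_smul, D.d_one, smul_zero]

/-- For a connected `A` there are no nonzero coboundaries in degree `1`, so that `H¹(A)` is a
subspace of `A¹`, namely `{η ∈ A¹ | dη = 0}`. This is the inclusion `H¹(A) → A¹`. -/
def h1Incl (D : CDGA 𝒜) (hD : D.IsConnected) : D.H 1 →ₗ[ℂ] 𝒜 1 :=
  Submodule.liftQ _ (LinearMap.ker (D.dDeg 1)).subtype (by
    intro x hx
    have hx' : (x : 𝒜 1) ∈ coboundaries D.dDeg 1 := hx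
    rw [D.coboundaries_one_of_isConnected hD] at hx'
    simpa using hx')

end CDGA

/-! ### The Chevalley–Eilenberg algebra -/

namespace ChevalleyEilenberg

open ExteriorAlgebra CliffordAlgebra

set_option linter.unusedSectionVars false

variable (𝔥 : Type*) [LieRing 𝔥] [LieAlgebra ℂ 𝔥] [FiniteDimensional ℂ 𝔥]

/-- The exterior algebra on the dual of `𝔥`. -/
abbrev Alg : Type _ := ExteriorAlgebra ℂ (Module.Dual ℂ 𝔥)

/-- The exterior powers of the dual of `𝔥`. -/
abbrev grading (i : ℕ) : Submodule ℂ (Alg 𝔥) := ⋀[ℂ]^i (Module.Dual ℂ 𝔥)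

/-- The element `eⁱ` of the exterior algebra, for the dual basis of a basis `(eᵢ)` of `𝔥`. -/
def gen (i : Fin (Module.finrank ℂ 𝔥)) : Alg 𝔥 :=
  ExteriorAlgebra.ι ℂ ((Module.finBasis ℂ 𝔥).coord i)

/-- The differential on `𝔥*`, dual to minus the Lie bracket:
`dφ = -½ ∑ᵢⱼ φ([eᵢ, eⱼ]) eⁱ ∧ eʲ`, that is, `(dφ)(x, y) = -φ([x, y])`. -/
def dGen : Module.Dual ℂ 𝔥 →ₗ[ℂ] Alg 𝔥 :=
  (-1 / 2 : ℂ) • ∑ i, ∑ j, LinearMap.smulRight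
    (Module.Dual.eval ℂ 𝔥 ⁅Module.finBasis ℂ 𝔥 i, Module.finBasis ℂ 𝔥 j⁆) (gen 𝔥 i * gen 𝔥 j)

variable {𝔥}

theorem dGen_apply (φ : Module.Dual ℂ 𝔥) : dGen 𝔥 φ = (-1 / 2 : ℂ) • ∑ i, ∑ j,
    φ ⁅Module.finBasis ℂ 𝔥 i, Module.finBasis ℂ 𝔥 j⁆ • (gen 𝔥 i * gen 𝔥 j) := by
  simp [dGen, LinearMap.sum_apply]

theorem ι_mul_swap (x y : Module.Dual ℂ 𝔥) :
    ExteriorAlgebra.ι ℂ x * ExteriorAlgebra.ι ℂ y =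
      -(ExteriorAlgebra.ι ℂ y * ExteriorAlgebra.ι ℂ x) :=
  eq_neg_of_add_eq_zero_left (ExteriorAlgebra.ι_add_mul_swap x y)

theorem ι_mul (x : Module.Dual ℂ 𝔥) (b : Alg 𝔥) :
    ExteriorAlgebra.ι ℂ x * b = involute b * ExteriorAlgebra.ι ℂ x := by
  induction b using ExteriorAlgebra.induction with
  | algebraMap r => simp [Algebra.commutes]
  | ι y =>
    rw [ι_mul_swap]
    erw [involute_ι]
    simp
  | mul a b ha hb => rw [← mul_assoc, ha, mul_assoc, hb, map_mul, mul_assoc]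
  | add a b ha hb => rw [mul_add, ha, hb, map_add, add_mul]

theorem involute_gen (i : Fin (Module.finrank ℂ 𝔥)) : involute (gen 𝔥 i) = -gen 𝔥 i :=
  involute_ι _

theorem involute_dGen (φ : Module.Dual ℂ 𝔥) : involute (dGen 𝔥 φ) = dGen 𝔥 φ := by
  simp [dGen_apply, involute_gen]

theorem dGen_comm (φ ψ : Module.Dual ℂ 𝔥) :
    ExteriorAlgebra.ι ℂ φ * dGen 𝔥 ψ = dGen 𝔥 ψ * ExteriorAlgebra.ι ℂ φ := by
  rw [ι_mul, involute_dGen]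

variable (𝔥) in
/-- The algebra map `a ↦ [[±a, da], [0, a]]`, whose upper right entry is the antiderivation
extending `dGen`. -/
def dHom : Alg 𝔥 →ₐ[ℂ] Matrix (Fin 2) (Fin 2) (Alg 𝔥) :=
  ExteriorAlgebra.lift ℂ
    ⟨{ toFun := fun φ => !![-ExteriorAlgebra.ι ℂ φ, dGen 𝔥 φ; 0, ExteriorAlgebra.ι ℂ φ]
       map_add' := fun φ ψ => by
        ext i j
        fin_cases i <;> fin_cases j <;> simp [add_comm]
       map_smul' := fun c φ => by
        ext i j
        fin_cases i <;> fin_cases j <;> simp },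
     fun φ => by
      ext i j
      fin_cases i <;> fin_cases j <;> simp [Matrix.mul_apply, dGen_comm]⟩

theorem dHom_ι (φ : Module.Dual ℂ 𝔥) : dHom 𝔥 (ExteriorAlgebra.ι ℂ φ) =
    !![-ExteriorAlgebra.ι ℂ φ, dGen 𝔥 φ; 0, ExteriorAlgebra.ι ℂ φ] :=
  ExteriorAlgebra.lift_ι_apply ℂ _ _ φ

theorem dHom_entries (a : Alg 𝔥) :
    dHom 𝔥 a 0 0 = involute a ∧ dHom 𝔥 a 1 0 = 0 ∧ dHom 𝔥 a 1 1 = a := by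
  induction a using ExteriorAlgebra.induction with
  | algebraMap r =>
    simp [AlgHom.commutes, Matrix.algebraMap_matrix_apply]
  | ι y =>
    refine ⟨?_, ?_, ?_⟩
    · rw [dHom_ι]
      exact (involute_ι _).symm
    · rw [dHom_ι]; rfl
    · rw [dHom_ι]; rfl
  | mul a b ha hb =>
    simp [Matrix.mul_apply, ha, hb]
  | add a b ha hb => simp [ha, hb]

variable (𝔥) in
/-- The Chevalley–Eilenberg differential: the unique antiderivation of the exterior algebra
extending `dGen`. -/
def d : Alg 𝔥 →ₗ[ℂ] Alg 𝔥 where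
  toFun a := dHom 𝔥 a 0 1
  map_add' a b := by simp
  map_smul' c a := by simp

theorem d_ι (φ : Module.Dual ℂ 𝔥) : d 𝔥 (ExteriorAlgebra.ι ℂ φ) = dGen 𝔥 φ := by
  change dHom 𝔥 (ExteriorAlgebra.ι ℂ φ) 0 1 = _
  rw [dHom_ι]; rfl

theorem d_algebraMap (r : ℂ) : d 𝔥 (algebraMap ℂ _ r) = 0 := by
  change dHom 𝔥 (algebraMap ℂ _ r) 0 1 = _
  simp [AlgHom.commutes, Matrix.algebraMap_matrix_apply]

theorem d_mul (a b : Alg 𝔥) : d 𝔥 (a * b) = d 𝔥 a * b + involute a * d 𝔥 b := by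
  change dHom 𝔥 _ 0 1 = dHom 𝔥 a 0 1 * b + involute a * dHom 𝔥 b 0 1
  simp [Matrix.mul_apply, dHom_entries, add_comm]

theorem d_involute (a : Alg 𝔥) : d 𝔥 (involute a) = -involute (d 𝔥 a) := by
  induction a using ExteriorAlgebra.induction with
  | algebraMap r => simp [d_algebraMap]
  | ι y =>
    rw [d_ι, involute_dGen]
    erw [involute_ι]
    rw [map_neg]
    exact congrArg Neg.neg (d_ι y)
  | mul a b ha hb => simp [d_mul, ha, hb, add_comm]
  | add a b ha hb => simp [ha, hb, add_comm]

theorem involute_of_mem {i : ℕ} {a : Alg 𝔥} (ha : a ∈ grading 𝔥 i) :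
    involute a = (-1 : ℂ) ^ i • a := by
  induction ha using Submodule.pow_induction_on_left' with
  | algebraMap r => simp
  | add x y i hx hy ihx ihy => simp [ihx, ihy]
  | mem_mul m hm i x hx ih =>
    obtain ⟨φ, rfl⟩ := hm
    have h : involute (ExteriorAlgebra.ι ℂ φ) = -ExteriorAlgebra.ι ℂ φ := involute_ι _
    rw [map_mul, ih, h, pow_succ]
    simp

theorem dGen_mem (φ : Module.Dual ℂ 𝔥) : dGen 𝔥 φ ∈ grading 𝔥 2 := by
  rw [dGen_apply]
  refine Submodule.smul_mem _ _ (Submodule.sum_mem _ fun i _ => Submodule.sum_mem _ fun j _ =>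
    Submodule.smul_mem _ _ ?_)
  change _ ∈ LinearMap.range (ExteriorAlgebra.ι ℂ) ^ 2
  rw [pow_two]
  exact Submodule.mul_mem_mul (LinearMap.mem_range_self _ _) (LinearMap.mem_range_self _ _)

theorem d_mem {i : ℕ} {a : Alg 𝔥} (ha : a ∈ grading 𝔥 i) : d 𝔥 a ∈ grading 𝔥 (i + 1) := by
  induction ha using Submodule.pow_induction_on_left' with
  | algebraMap r => simp [d_algebraMap]
  | add x y i hx hy ihx ihy => simpa using Submodule.add_mem _ ihx ihy
  | mem_mul m hm i x hx ih =>
    obtain ⟨φ, rfl⟩ := hm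
    have h : involute (ExteriorAlgebra.ι ℂ φ) = -ExteriorAlgebra.ι ℂ φ := involute_ι _
    rw [d_mul, d_ι, h]
    refine Submodule.add_mem _ ?_ ?_
    · have := SetLike.mul_mem_graded (A := grading 𝔥) (dGen_mem φ) hx
      rwa [show 2 + i = i + 1 + 1 by omega] at this
    · rw [neg_mul]
      refine Submodule.neg_mem _ ?_
      have h1 : ExteriorAlgebra.ι ℂ φ ∈ grading 𝔥 1 := by
        change _ ∈ LinearMap.range (ExteriorAlgebra.ι ℂ) ^ 1
        rw [pow_one]
        exact LinearMap.mem_range_self _ _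
      have := SetLike.mul_mem_graded (A := grading 𝔥) h1 ih
      rwa [show 1 + (i + 1) = i + 1 + 1 by omega] at this

theorem graded_comm {i j : ℕ} {a b : Alg 𝔥} (ha : a ∈ grading 𝔥 i) (hb : b ∈ grading 𝔥 j) :
    a * b = (-1 : ℂ) ^ (i * j) • (b * a) := by
  induction ha using Submodule.pow_induction_on_left' with
  | algebraMap r => simp [Algebra.commutes]
  | add x y i hx hy ihx ihy => rw [add_mul, ihx, ihy, mul_add, smul_add]
  | mem_mul m hm i x hx ih =>
    obtain ⟨φ, rfl⟩ := hm
    rw [mul_assoc, ih, mul_smul_comm, ← mul_assoc, ι_mul, involute_of_mem hb, smul_mul_assoc,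
      smul_mul_assoc, smul_smul, mul_assoc, ← pow_add]
    rw [Nat.succ_mul]

theorem d_d_ι (φ : Module.Dual ℂ 𝔥) : d 𝔥 (dGen 𝔥 φ) = 0 := by
  have hswap : ∀ i j, gen 𝔥 i * gen 𝔥 j = -(gen 𝔥 j * gen 𝔥 i) := fun i j => ι_mul_swap _ _
  have hdg : ∀ i, d 𝔥 (gen 𝔥 i) = dGen 𝔥 ((Module.finBasis ℂ 𝔥).coord i) := fun i => d_ι _
  have hD := dGen_apply (𝔥 := 𝔥)
  have hc : ∀ i ψ, gen 𝔥 i * dGen 𝔥 ψ = dGen 𝔥 ψ * gen 𝔥 i := fun i ψ => dGen_comm _ ψ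
  generalize Module.finBasis ℂ 𝔥 = b at hdg hD
  -- reduce to one half of the Leibniz expansion
  have h1 : d 𝔥 (dGen 𝔥 φ) = -∑ i, ∑ j, φ ⁅b i, b j⁆ • (dGen 𝔥 (b.coord i) * gen 𝔥 j) := by
    have h2 : ∑ i, ∑ j, φ ⁅b i, b j⁆ • (gen 𝔥 i * dGen 𝔥 (b.coord j)) =
        -∑ i, ∑ j, φ ⁅b i, b j⁆ • (dGen 𝔥 (b.coord i) * gen 𝔥 j) := by
      rw [Finset.sum_comm, ← Finset.sum_neg_distrib]
      refine Finset.sum_congr rfl fun i _ => ?_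
      rw [← Finset.sum_neg_distrib]
      refine Finset.sum_congr rfl fun j _ => ?_
      rw [hc, ← lie_skew, map_neg, neg_smul]
    have h3 : d 𝔥 (dGen 𝔥 φ) = (-1 / 2 : ℂ) •
        (∑ i, ∑ j, φ ⁅b i, b j⁆ • (dGen 𝔥 (b.coord i) * gen 𝔥 j) -
          ∑ i, ∑ j, φ ⁅b i, b j⁆ • (gen 𝔥 i * dGen 𝔥 (b.coord j))) := by
      rw [hD, map_smul, map_sum, ← Finset.sum_sub_distrib]
      congr 1
      refine Finset.sum_congr rfl fun i _ => ?_
      rw [map_sum, ← Finset.sum_sub_distrib]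
      refine Finset.sum_congr rfl fun j _ => ?_
      rw [map_smul, d_mul, hdg, hdg, involute_gen, neg_mul, ← sub_eq_add_neg, smul_sub]
    rw [h3, h2]
    module
  have h5 : ∀ j k l, φ ⁅⁅b k, b l⁆, b j⁆ = ∑ i, φ ⁅b i, b j⁆ * b.coord i ⁅b k, b l⁆ := by
    intro j k l
    have h6 := congrArg (fun x => φ ⁅x, b j⁆) (b.sum_repr ⁅b k, b l⁆)
    simp only [sum_lie, smul_lie, map_sum, map_smul, smul_eq_mul] at h6
    rw [← h6]
    exact Finset.sum_congr rfl fun i _ => mul_comm _ _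
  have h4 : ∀ j, ∑ i, φ ⁅b i, b j⁆ • (dGen 𝔥 (b.coord i) * gen 𝔥 j) =
      (-1 / 2 : ℂ) • ∑ k, ∑ l, φ ⁅⁅b k, b l⁆, b j⁆ • (gen 𝔥 k * gen 𝔥 l * gen 𝔥 j) := by
    intro j
    simp only [h5, hD, smul_mul_assoc, Finset.sum_mul, Finset.sum_smul, Finset.smul_sum,
      smul_smul]
    rw [Finset.sum_comm]
    refine Finset.sum_congr rfl fun k _ => ?_
    rw [Finset.sum_comm]
    refine Finset.sum_congr rfl fun l _ => Finset.sum_congr rfl fun i _ => ?_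
    congr 1
    ring
  -- the sum is invariant under cyclic permutations, and three copies of it add up to zero
  have hcyc : ∀ i j k, gen 𝔥 i * gen 𝔥 j * gen 𝔥 k = gen 𝔥 j * gen 𝔥 k * gen 𝔥 i := by
    intro i j k
    rw [hswap i j, neg_mul, mul_assoc, hswap i k, mul_neg, neg_neg, mul_assoc]
  have h7 : ∑ j, ∑ k, ∑ l, φ ⁅⁅b k, b l⁆, b j⁆ • (gen 𝔥 k * gen 𝔥 l * gen 𝔥 j) = 0 := by
    have hrot : ∀ F : Fin (Module.finrank ℂ 𝔥) → Fin (Module.finrank ℂ 𝔥) →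
        Fin (Module.finrank ℂ 𝔥) → Alg 𝔥,
        ∑ j, ∑ k, ∑ l, F j k l = ∑ j, ∑ k, ∑ l, F k l j := by
      intro F
      calc ∑ j, ∑ k, ∑ l, F j k l = ∑ k, ∑ l, ∑ j, F k l j := rfl
        _ = ∑ k, ∑ j, ∑ l, F k l j := Finset.sum_congr rfl fun k _ => Finset.sum_comm
        _ = ∑ j, ∑ k, ∑ l, F k l j := Finset.sum_comm
    have hA : ∑ j, ∑ k, ∑ l, φ ⁅⁅b k, b l⁆, b j⁆ • (gen 𝔥 k * gen 𝔥 l * gen 𝔥 j) =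
        ∑ j, ∑ k, ∑ l, φ ⁅⁅b l, b j⁆, b k⁆ • (gen 𝔥 k * gen 𝔥 l * gen 𝔥 j) := by
      rw [hrot]
      refine Finset.sum_congr rfl fun j _ => Finset.sum_congr rfl fun k _ =>
        Finset.sum_congr rfl fun l _ => ?_
      rw [hcyc k l j]
    have hB : ∑ j, ∑ k, ∑ l, φ ⁅⁅b l, b j⁆, b k⁆ • (gen 𝔥 k * gen 𝔥 l * gen 𝔥 j) =
        ∑ j, ∑ k, ∑ l, φ ⁅⁅b j, b k⁆, b l⁆ • (gen 𝔥 k * gen 𝔥 l * gen 𝔥 j) := by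
      rw [hrot]
      refine Finset.sum_congr rfl fun j _ => Finset.sum_congr rfl fun k _ =>
        Finset.sum_congr rfl fun l _ => ?_
      rw [hcyc k l j]
    have hsum : ∑ j, ∑ k, ∑ l, φ ⁅⁅b k, b l⁆, b j⁆ • (gen 𝔥 k * gen 𝔥 l * gen 𝔥 j) +
        ∑ j, ∑ k, ∑ l, φ ⁅⁅b l, b j⁆, b k⁆ • (gen 𝔥 k * gen 𝔥 l * gen 𝔥 j) +
        ∑ j, ∑ k, ∑ l, φ ⁅⁅b j, b k⁆, b l⁆ • (gen 𝔥 k * gen 𝔥 l * gen 𝔥 j) = 0 := by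
      simp only [← Finset.sum_add_distrib, ← add_smul, ← map_add]
      refine Finset.sum_eq_zero fun j _ => Finset.sum_eq_zero fun k _ =>
        Finset.sum_eq_zero fun l _ => ?_
      have hJ : ⁅⁅b k, b l⁆, b j⁆ + ⁅⁅b l, b j⁆, b k⁆ + ⁅⁅b j, b k⁆, b l⁆ = 0 := by
        have e : ∀ x y z : 𝔥, ⁅x, ⁅y, z⁆⁆ = -⁅⁅y, z⁆, x⁆ := fun x y z => (lie_skew _ _).symm
        have := lie_jacobi (b j) (b k) (b l)
        rw [e, e, e] at this
        rw [← neg_eq_zero, ← this]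
        abel
      rw [hJ, map_zero, zero_smul]
    rw [← hB, ← hA] at hsum
    have h3 : (3 : ℂ) • ∑ j, ∑ k, ∑ l,
        φ ⁅⁅b k, b l⁆, b j⁆ • (gen 𝔥 k * gen 𝔥 l * gen 𝔥 j) = 0 := by
      rw [← hsum]
      module
    exact (smul_eq_zero.mp h3).resolve_left (by norm_num)
  simp only [h1]
  rw [Finset.sum_comm]
  simp only [h4, ← Finset.smul_sum, h7, smul_zero, neg_zero]

theorem d_d (a : Alg 𝔥) : d 𝔥 (d 𝔥 a) = 0 := by
  induction a using ExteriorAlgebra.induction with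
  | algebraMap r => simp [d_algebraMap]
  | ι y => rw [d_ι, d_d_ι]
  | mul a b ha hb => simp [d_mul, ha, hb, d_involute]
  | add a b ha hb => simp [ha, hb]

variable (𝔥) in
/-- The Chevalley–Eilenberg cochain algebra `𝒞𝔥 = (⋀ 𝔥*, d)`; its cohomology is the Lie algebra
cohomology of `𝔥` with trivial coefficients `ℂ`. -/
def cdga : CDGA (grading 𝔥) where
  d := d 𝔥
  d_mem := d_mem
  d_d := d_d
  leibniz ha b := by rw [d_mul, involute_of_mem ha, smul_mul_assoc]
  graded_comm := graded_comm

variable (𝔥) in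
theorem isConnected : (cdga 𝔥).IsConnected := by
  change (LinearMap.range (ExteriorAlgebra.ι ℂ)) ^ 0 = _
  rw [pow_zero, Submodule.one_eq_span]

end ChevalleyEilenberg

/-! ### Germs at the origin -/

/-- The filter of neighbourhoods of `0` in a finite-dimensional complex vector space, for its
canonical (Euclidean) topology. -/
def nhdsZero (E : Type*) [AddCommGroup E] [Module ℂ E] : Filter E :=
  @nhds E (moduleTopology ℂ E) 0

/-- The subsets `X` and `Y` of `E` have the same germ at `0`: they coincide near `0`. -/
def GermEq {E : Type*} [AddCommGroup E] [Module ℂ E] (X Y : Set E) : Prop :=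
  ∀ᶠ x in nhdsZero E, x ∈ X ↔ x ∈ Y

/-- A map between finite-dimensional complex vector spaces is analytic at `0`
(in linear coordinates, the choice of which does not matter). -/
def AnalyticAtZero {E F : Type*} [AddCommGroup E] [Module ℂ E] [FiniteDimensional ℂ E]
    [AddCommGroup F] [Module ℂ F] [FiniteDimensional ℂ F] (f : E → F) : Prop :=
  AnalyticAt ℂ (fun z => (Module.finBasis ℂ F).equivFun (f ((Module.finBasis ℂ E).equivFun.symm z))) 0

/-- The germs at `0` of `X ⊆ E` and `Y ⊆ F` (both containing `0`) are isomorphic as (reduced)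
analytic germs: there are maps `f : (E, 0) → (F, 0)` and `g : (F, 0) → (E, 0)`, analytic at `0`,
which near `0` restrict to mutually inverse maps between `X` and `Y`. -/
def GermIso {E F : Type*} [AddCommGroup E] [Module ℂ E] [FiniteDimensional ℂ E]
    [AddCommGroup F] [Module ℂ F] [FiniteDimensional ℂ F] (X : Set E) (Y : Set F) : Prop :=
  ∃ (f : E → F) (g : F → E), AnalyticAtZero f ∧ AnalyticAtZero g ∧ f 0 = 0 ∧ g 0 = 0 ∧
    (∀ᶠ x in nhdsZero E, x ∈ X → f x ∈ Y ∧ g (f x) = x) ∧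
    (∀ᶠ y in nhdsZero F, y ∈ Y → g y ∈ X ∧ f (g y) = y)

/-! ### Cones over projective sets -/

/-- The affine cone in `E` over a subset of `ℙ(E)`. -/
def cone {E : Type*} [AddCommGroup E] [Module ℂ E] (S : Set (ℙ ℂ E)) : Set E :=
  {x | x = 0 ∨ ∃ hx : x ≠ 0, Projectivization.mk ℂ x hx ∈ S}

/-- The product `S × T` of `S ⊆ ℙ(E)` and `T ⊆ ℙ(F)`, as a subset of `ℙ(E ⊗ F)` through the
Segre embedding `([x], [y]) ↦ [x ⊗ y]`. -/
def segre {E F : Type*} [AddCommGroup E] [Module ℂ E] [AddCommGroup F] [Module ℂ F]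
    (S : Set (ℙ ℂ E)) (T : Set (ℙ ℂ F)) : Set (ℙ ℂ (E ⊗[ℂ] F)) :=
  {p | ∃ (x : E) (y : F) (hx : x ≠ 0) (hy : y ≠ 0) (hxy : x ⊗ₜ[ℂ] y ≠ 0),
    Projectivization.mk ℂ x hx ∈ S ∧ Projectivization.mk ℂ y hy ∈ T ∧
      p = Projectivization.mk ℂ (x ⊗ₜ[ℂ] y) hxy}

/-- The zero set in `ℙ(E)` of a homogeneous function on `E`. -/
def projZeros {E : Type*} [AddCommGroup E] [Module ℂ E] (f : E → ℂ) : Set (ℙ ℂ E) :=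
  {p | ∀ x ∈ p.submodule, f x = 0}

/-- The Lie algebra `sl₂(ℂ)`. -/
abbrev sl₂ : Type := LieAlgebra.SpecialLinear.sl (Fin 2) ℂ

end

/-! ### Determinants near the origin -/

/-! A flat connection `ω` is the same as a Lie algebra homomorphism `ρ : 𝔥 → sl₂` (`toHom`,
`toHom_lie`). Near `0` its image is abelian. Indeed, `ad(u)³ = -4 det(u) ad(u)` in `sl₂`, so if `u =
ρ(x)` is not central in the image, then `-4 det u` is an eigenvalue of the transpose of `ad(x)²`.
These eigenvalues are finitely many and do not depend on `ω`, so smallness forces `det u = 0`. A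
nonabelian image has no nonzero central element, hence `det` vanishes on the basis vectors and their
pairwise sums; polarization makes them orthogonal null vectors, and such vectors commute. An abelian
subalgebra of `sl₂` is at most a line, so `ω = η ⊗ g` with `dη = 0` (`eventually_exists_eq_tmul`).
Conversely every such tensor is flat.

Resonance is then decided for `ω = η ⊗ g`. If `Hⁱ(A) = 0`, a contracting homotopy of `d` is, for
small `ω`, still a homotopy from `d_ω` to an invertible operator, so `d_ω` is exact in degree `i`
(`eventually_ker_covDeriv_le`). If `θ(g)` is singular, its kernel and cokernel let exactness of
`d_ω` descend to `d`, so `Hⁱ(A) ≠ 0` forces resonance (`ker_dDeg_le_of_ker_covDeriv_le`). If `θ(g)`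
is invertible and `ω ≠ 0` is small, choose `x` with `η(x) ≠ 0`. Cartan's formula shows that `L_x ⊗ 1
+ 1 ⊗ η(x)θ(g)` is null-homotopic for `d_ω`. Its eigenvalues are sums of a fixed eigenvalue of `L_x`
and a small nonzero number, hence nonzero, so the cohomology vanishes
(`eventually_ker_covDeriv_le_of_det_ne_zero`). -/

theorem tendsto_det_nhdsZero {E n : Type*} [AddCommGroup E] [Module ℂ E] [Fintype n]
    [DecidableEq n] (φ : E →ₗ[ℂ] Matrix n n ℂ) (M : Matrix n n ℂ) :
    Filter.Tendsto (fun x => (M + φ x).det) (nhdsZero E) (nhds M.det) := by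
  let _ : TopologicalSpace E := moduleTopology ℂ E
  have _ : IsModuleTopology ℂ E := ⟨rfl⟩
  have hφ : Continuous φ := IsModuleTopology.continuous_of_linearMap φ
  have h : Continuous fun x => (M + φ x).det := (continuous_const.add hφ).matrix_det
  have h0 := h.tendsto 0
  simp only [map_zero, add_zero] at h0
  exact h0

/-- Linear maps are continuous for the module topology, so invertibility is an open condition. The
smallness conditions on the cohomological side all come from here. -/
theorem eventually_det_add_ne_zero {E W : Type*} [AddCommGroup E] [Module ℂ E]
    [AddCommGroup W] [Module ℂ W] [FiniteDimensional ℂ W] (φ : E →ₗ[ℂ] Module.End ℂ W)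
    (N : Module.End ℂ W) (hN : LinearMap.det N ≠ 0) :
    ∀ᶠ x in nhdsZero E, LinearMap.det (N + φ x) ≠ 0 := by
  let b := Module.finBasis ℂ W
  have h := tendsto_det_nhdsZero ((LinearMap.toMatrix b b).toLinearMap ∘ₗ φ)
    (LinearMap.toMatrix b b N)
  rw [LinearMap.det_toMatrix] at h
  filter_upwards [h.eventually_ne hN] with x hx
  rw [← LinearMap.det_toMatrix b, map_add]
  exact hx

/-! ### Exactness criteria -/

theorem LinearMap.injective_of_det_ne_zero {W : Type*} [AddCommGroup W] [Module ℂ W]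
    [FiniteDimensional ℂ W] {f : Module.End ℂ W} (hf : LinearMap.det f ≠ 0) :
    Function.Injective f :=
  LinearMap.ker_eq_bot.mp ((LinearMap.isUnit_iff_ker_eq_bot _).mp
    ((LinearMap.isUnit_iff_isUnit_det _).mpr hf.isUnit))

/-- A dimension count: `f` embeds `K` into its own subspace `B`. With `K` the cocycles and `B` the
coboundaries, an injective null-homotopic operator kills the cohomology. -/
theorem Submodule.le_of_injective_of_mapsTo {E : Type*} [AddCommGroup E] [Module ℂ E]
    [FiniteDimensional ℂ E] {K B : Submodule ℂ E} (hBK : B ≤ K) (f : Module.End ℂ E)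
    (hf : Function.Injective f) (h : ∀ z ∈ K, f z ∈ B) : K ≤ B := by
  have h1 : K.map f ≤ B := by
    rintro _ ⟨z, hz, rfl⟩
    exact h z hz
  have h2 : Module.finrank ℂ K ≤ Module.finrank ℂ B := by
    rw [(Submodule.equivMapOfInjective f hf K).finrank_eq]
    exact Submodule.finrank_mono h1
  exact (Submodule.eq_of_le_of_finrank_le hBK h2).ge

section Cohomology

variable {C : ℕ → Type*} [∀ i, AddCommGroup (C i)] [∀ i, Module ℂ (C i)]
  (δ : ∀ i, C i →ₗ[ℂ] C (i + 1))

theorem subsingleton_cochainCohomology_iff (i : ℕ) :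
    Subsingleton (cochainCohomology δ i) ↔ LinearMap.ker (δ i) ≤ coboundaries δ i := by
  rw [Submodule.Quotient.subsingleton_iff, Submodule.submoduleOf_eq_top]

theorem coboundaries_le_ker (hδ : ∀ i x, δ (i + 1) (δ i x) = 0) (i : ℕ) :
    coboundaries δ i ≤ LinearMap.ker (δ i) := by
  cases i with
  | zero => exact bot_le
  | succ i =>
    rintro _ ⟨x, rfl⟩
    exact hδ i x

/-- An exact sequence of vector spaces splits. -/
theorem exists_splitting (i : ℕ) (h : LinearMap.ker (δ (i + 1)) ≤ LinearMap.range (δ i)) :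
    ∃ (s : C (i + 1) →ₗ[ℂ] C i) (t : C (i + 2) →ₗ[ℂ] C (i + 1)),
      δ i ∘ₗ s + t ∘ₗ δ (i + 1) = LinearMap.id := by
  -- `t` extends a section of `δ (i + 1)` over its range, so `1 - t δ` projects onto the kernel,
  -- which exactness places in the range of `δ i`; `s` composes this projection with a section of `δ
  -- i`.
  obtain ⟨r, hr⟩ := (δ (i + 1)).rangeRestrict.exists_rightInverse_of_surjective
    (LinearMap.range_rangeRestrict _)
  obtain ⟨t, ht⟩ := LinearMap.exists_extend r
  have hdt : ∀ x, δ (i + 1) (t (δ (i + 1) x)) = δ (i + 1) x := fun x => by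
    have h1 := LinearMap.congr_fun ht ((δ (i + 1)).rangeRestrict x)
    have h2 := congrArg Subtype.val (LinearMap.congr_fun hr ((δ (i + 1)).rangeRestrict x))
    rw [LinearMap.comp_apply, ← h1] at h2
    exact h2
  obtain ⟨q, hq⟩ := (δ i).rangeRestrict.exists_rightInverse_of_surjective
    (LinearMap.range_rangeRestrict _)
  have hp : ∀ x : C (i + 1), ((LinearMap.id - t ∘ₗ δ (i + 1) : Module.End ℂ (C (i + 1))) x) ∈ LinearMap.range (δ i) := fun x => h (by
    simp [hdt])
  refine ⟨q ∘ₗ (LinearMap.id - t ∘ₗ δ (i + 1)).codRestrict _ hp, t, LinearMap.ext fun x => ?_⟩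
  have h3 := congrArg Subtype.val (LinearMap.congr_fun hq ⟨_, hp x⟩)
  change δ i (q ⟨_, hp x⟩) = _ at h3
  change δ i (q ⟨_, hp x⟩) + t (δ (i + 1) x) = x
  rw [h3]
  simp

end Cohomology

/-! ### Sums of commuting operators on a tensor product -/

/-- If `T - μ` is injective, it stays so after tensoring, by flatness over a field. -/
theorem hasEigenvalue_of_lTensor {M V : Type*} [AddCommGroup M] [Module ℂ M]
    [AddCommGroup V] [Module ℂ V] [FiniteDimensional ℂ V] (T : Module.End ℂ V) {μ : ℂ}
    {z : M ⊗[ℂ] V} (hz : z ≠ 0) (h : T.lTensor M z = μ • z) : T.HasEigenvalue μ := by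
  by_contra hμ
  have hinj : Function.Injective (T - algebraMap ℂ (Module.End ℂ V) μ) := by
    rw [← LinearMap.ker_eq_bot]
    rw [Module.End.hasEigenvalue_iff, not_not, Module.End.eigenspace_def] at hμ
    exact hμ
  have h1 := Module.Flat.lTensor_preserves_injective_linearMap (M := M) _ hinj
  refine hz (h1 ?_)
  rw [map_zero, LinearMap.lTensor_sub, LinearMap.sub_apply, h]
  have h2 : (algebraMap ℂ (Module.End ℂ V) μ) = μ • LinearMap.id := rfl
  rw [h2, LinearMap.lTensor_smul, LinearMap.smul_apply, LinearMap.lTensor_id]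
  simp

theorem hasEigenvalue_of_rTensor {M V : Type*} [AddCommGroup M] [Module ℂ M]
    [AddCommGroup V] [Module ℂ V] [FiniteDimensional ℂ V] (T : Module.End ℂ V) {μ : ℂ}
    {z : V ⊗[ℂ] M} (hz : z ≠ 0) (h : T.rTensor M z = μ • z) : T.HasEigenvalue μ := by
  refine hasEigenvalue_of_lTensor T (M := M) (z := TensorProduct.comm ℂ V M z) (by simpa using hz) ?_
  rw [← LinearEquiv.map_smul, ← h]
  exact LinearMap.congr_fun (LinearMap.lTensor_comp_comm T) z

/-- The two summands commute, so a nonzero kernel is stable under `1 ⊗ T` and contains an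
eigenvector of it, with eigenvalue `μ` say. On that vector `L ⊗ 1` acts as `-μ`. -/
theorem injective_rTensor_add_lTensor {M V : Type*} [AddCommGroup M] [Module ℂ M]
    [FiniteDimensional ℂ M] [AddCommGroup V] [Module ℂ V] [FiniteDimensional ℂ V]
    (L : Module.End ℂ M) (T : Module.End ℂ V)
    (h : ∀ μ, T.HasEigenvalue μ → ¬ L.HasEigenvalue (-μ)) :
    Function.Injective (L.rTensor V + T.lTensor M) := by
  rw [← LinearMap.ker_eq_bot]
  by_contra hK
  have hcomm : ∀ z, L.rTensor V (T.lTensor M z) = T.lTensor M (L.rTensor V z) := fun z => by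
    rw [← LinearMap.comp_apply, ← LinearMap.comp_apply, LinearMap.rTensor_comp_lTensor,
      LinearMap.lTensor_comp_rTensor]
  have hker : ∀ z ∈ LinearMap.ker (L.rTensor V + T.lTensor M),
      T.lTensor M z ∈ LinearMap.ker (L.rTensor V + T.lTensor M) := fun z hz => by
    rw [LinearMap.mem_ker, LinearMap.add_apply] at hz ⊢
    rw [hcomm, ← map_add, hz, map_zero]
  have := Submodule.nontrivial_iff_ne_bot.mpr hK
  obtain ⟨μ, hμ⟩ := Module.End.exists_eigenvalue ((T.lTensor M).restrict hker)
  obtain ⟨z, hz⟩ := hμ.exists_hasEigenvector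
  have hz0 : (z : M ⊗[ℂ] V) ≠ 0 := fun h0 => hz.2 (Subtype.ext h0)
  have hT : T.lTensor M (z : M ⊗[ℂ] V) = μ • (z : M ⊗[ℂ] V) :=
    congrArg Subtype.val hz.apply_eq_smul
  have hL : L.rTensor V (z : M ⊗[ℂ] V) = (-μ) • (z : M ⊗[ℂ] V) := by
    have h1 : L.rTensor V (z : M ⊗[ℂ] V) + T.lTensor M (z : M ⊗[ℂ] V) = 0 := z.2
    rw [neg_smul, ← hT]
    exact eq_neg_of_add_eq_zero_left h1
  exact h μ (hasEigenvalue_of_lTensor T hz0 hT) (hasEigenvalue_of_rTensor L hz0 hL)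

/-! ### The Lie algebra `sl₂` -/

namespace sl₂

theorem apply_one_one (u : sl₂) : u.1 1 1 = -u.1 0 0 := by
  have h : Matrix.trace u.1 = 0 := u.2
  rw [Matrix.trace_fin_two] at h
  exact eq_neg_of_add_eq_zero_right h

theorem smul_apply (c : ℂ) (u : sl₂) (i j : Fin 2) : (c • u).1 i j = c * u.1 i j := rfl

theorem add_apply (u v : sl₂) (i j : Fin 2) : (u + v).1 i j = u.1 i j + v.1 i j := rfl

theorem zero_apply (i j : Fin 2) : (0 : sl₂).1 i j = 0 := rfl

theorem ext_iff' {u v : sl₂} :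
    u = v ↔ u.1 0 0 = v.1 0 0 ∧ u.1 0 1 = v.1 0 1 ∧ u.1 1 0 = v.1 1 0 := by
  refine ⟨fun h => by simp [h], fun ⟨h1, h2, h3⟩ => Subtype.ext ?_⟩
  ext i j
  fin_cases i <;> fin_cases j
  · exact h1
  · exact h2
  · exact h3
  · change u.1 1 1 = v.1 1 1
    rw [apply_one_one, apply_one_one, h1]

theorem det_eq (u : sl₂) : u.1.det = -(u.1 0 0 ^ 2 + u.1 0 1 * u.1 1 0) := by
  rw [Matrix.det_fin_two, apply_one_one]
  ring

theorem lie_zero_zero (u v : sl₂) :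
    ⁅u, v⁆.1 0 0 = u.1 0 1 * v.1 1 0 - v.1 0 1 * u.1 1 0 := by
  rw [LieSubalgebra.coe_bracket, LieRing.of_associative_ring_bracket]
  simp only [Matrix.sub_apply, Matrix.mul_apply, Fin.sum_univ_two]
  ring

theorem lie_zero_one (u v : sl₂) :
    ⁅u, v⁆.1 0 1 = 2 * (u.1 0 0 * v.1 0 1 - v.1 0 0 * u.1 0 1) := by
  rw [LieSubalgebra.coe_bracket, LieRing.of_associative_ring_bracket]
  simp only [Matrix.sub_apply, Matrix.mul_apply, Fin.sum_univ_two, apply_one_one]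
  ring

theorem lie_one_zero (u v : sl₂) :
    ⁅u, v⁆.1 1 0 = 2 * (v.1 0 0 * u.1 1 0 - u.1 0 0 * v.1 1 0) := by
  rw [LieSubalgebra.coe_bracket, LieRing.of_associative_ring_bracket]
  simp only [Matrix.sub_apply, Matrix.mul_apply, Fin.sum_univ_two, apply_one_one]
  ring

/-- `ad(u)³ = -4 det(u) ad(u)` -/
theorem lie_lie_lie (u v : sl₂) : ⁅u, ⁅u, ⁅u, v⁆⁆⁆ = (-4 * u.1.det) • ⁅u, v⁆ := by
  rw [ext_iff', det_eq]
  refine ⟨?_, ?_, ?_⟩ <;>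
  simp only [lie_zero_zero, lie_zero_one, lie_one_zero, smul_apply] <;>
  ring

/-- The orthogonal null vectors of `sl₂` commute. -/
theorem lie_eq_zero_of_det {u v : sl₂} (hu : u.1.det = 0) (hv : v.1.det = 0)
    (huv : (u + v).1.det = 0) : ⁅u, v⁆ = 0 := by
  rw [det_eq, neg_eq_zero] at hu hv huv
  rw [ext_iff', lie_zero_zero, lie_zero_one, lie_one_zero]
  simp only [add_apply] at huv
  simp only [zero_apply]
  generalize u.1 0 0 = a at *
  generalize u.1 0 1 = b at *
  generalize u.1 1 0 = c at *
  generalize v.1 0 0 = a' at *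
  generalize v.1 0 1 = b' at *
  generalize v.1 1 0 = c' at *
  -- The polarization of `-det`. Modulo this relation and the two null conditions, the square of
  -- each entry of the bracket vanishes.
  have h : 2 * a * a' + b * c' + b' * c = 0 := by linear_combination huv - hu - hv
  refine ⟨?_, ?_, ?_⟩
  · refine pow_eq_zero_iff two_ne_zero |>.mp ?_
    linear_combination (b * c' + b' * c - 2 * a * a') * h - 4 * b' * c' * hu + 4 * a ^ 2 * hv
  · refine pow_eq_zero_iff two_ne_zero |>.mp ?_
    linear_combination 4 * b' ^ 2 * hu + 4 * b ^ 2 * hv - 4 * b * b' * h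
  · refine pow_eq_zero_iff two_ne_zero |>.mp ?_
    linear_combination 4 * c' ^ 2 * hu + 4 * c ^ 2 * hv - 4 * c * c' * h

/-- The centralizer of a nonzero element of `sl₂` is a line. -/
theorem exists_smul_of_lie_eq_zero {u v : sl₂} (hu : u ≠ 0) (h : ⁅u, v⁆ = 0) :
    ∃ c : ℂ, v = c • u := by
  have h' := ext_iff'.mp h
  rw [lie_zero_zero, lie_zero_one, lie_one_zero] at h'
  simp only [zero_apply, mul_eq_zero, two_ne_zero, false_or] at h'
  obtain ⟨h1, h2, h3⟩ := h'
  have hu' : ¬ (u.1 0 0 = 0 ∧ u.1 0 1 = 0 ∧ u.1 1 0 = 0) := fun hh => hu (ext_iff'.mpr (by simpa only [zero_apply] using hh))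
  simp only [ext_iff', smul_apply]
  generalize u.1 0 0 = a at *
  generalize u.1 0 1 = b at *
  generalize u.1 1 0 = c at *
  by_cases ha : a = 0
  · by_cases hb : b = 0
    · have hc : c ≠ 0 := fun hc => hu' ⟨ha, hb, hc⟩
      refine ⟨v.1 1 0 / c, ?_, ?_, ?_⟩ <;> field_simp <;> grind
    · refine ⟨v.1 0 1 / b, ?_, ?_, ?_⟩ <;> field_simp <;> grind
  · refine ⟨v.1 0 0 / a, ?_, ?_, ?_⟩ <;> field_simp <;> grind

end sl₂

/-! ### Covariant derivatives of decomposable closed forms -/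

namespace CDGA

variable {A : Type*} [Ring A] [Algebra ℂ A] {𝒜 : ℕ → Submodule ℂ A} [GradedAlgebra 𝒜]
  {𝔤 : Type*} [LieRing 𝔤] [LieAlgebra ℂ 𝔤] {V : Type*} [AddCommGroup V] [Module ℂ V]
  (D : CDGA 𝒜) (θ : 𝔤 →ₗ⁅ℂ⁆ Module.End ℂ V)

theorem dDeg_dDeg (i : ℕ) (a : 𝒜 i) : D.dDeg (i + 1) (D.dDeg i a) = 0 :=
  Subtype.ext (D.d_d a)

theorem dDeg_mulDeg {η : 𝒜 1} (hη : D.dDeg 1 η = 0) (i : ℕ) (a : 𝒜 i) :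
    D.dDeg (i + 1) (mulDeg 𝒜 i η a) = -mulDeg 𝒜 (i + 1) η (D.dDeg i a) := by
  refine Subtype.ext ?_
  have h0 : D.d (η : A) = 0 := congrArg Subtype.val hη
  change D.d ((η : A) * (a : A)) = -((η : A) * D.d (a : A))
  rw [D.leibniz η.2, h0]
  simp

include D in
theorem mulDeg_one_self (η : 𝒜 1) : mulDeg 𝒜 1 η η = 0 := by
  refine Subtype.ext ?_
  change (η : A) * (η : A) = 0
  have h := D.graded_comm η.2 η.2
  rw [mul_one, pow_one, neg_smul, one_smul] at h
  have h2 : (2 : ℂ) • ((η : A) * (η : A)) = 0 := by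
    rw [two_smul]
    nth_rewrite 1 [h]
    exact neg_add_cancel _
  exact (smul_eq_zero.mp h2).resolve_left two_ne_zero

include D in
theorem mulDeg_mulDeg_self (η : 𝒜 1) (i : ℕ) (a : 𝒜 i) :
    mulDeg 𝒜 (i + 1) η (mulDeg 𝒜 i η a) = 0 := by
  refine Subtype.ext ?_
  change (η : A) * ((η : A) * (a : A)) = 0
  have h : (η : A) * (η : A) = 0 := congrArg Subtype.val (D.mulDeg_one_self η)
  rw [← mul_assoc, h, zero_mul]

@[simp]
theorem act_tmul (i : ℕ) (η : 𝒜 1) (g : 𝔤) (a : 𝒜 i) (v : V) :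
    act 𝒜 θ i (η ⊗ₜ g) (a ⊗ₜ v) = mulDeg 𝒜 i η a ⊗ₜ θ g v := rfl

theorem covDeriv_tmul (i : ℕ) (η : 𝒜 1) (g : 𝔤) (a : 𝒜 i) (v : V) :
    D.covDeriv θ (η ⊗ₜ g) i (a ⊗ₜ v) = D.dDeg i a ⊗ₜ v + mulDeg 𝒜 i η a ⊗ₜ θ g v := rfl

/-- Both terms of the equation vanish separately, since `dη = 0` and `η ∧ η = 0`; no smallness is
needed. -/
theorem tmul_mem_flatConnections {η : 𝒜 1} (hη : D.dDeg 1 η = 0) (g : 𝔤) :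
    η ⊗ₜ g ∈ D.flatConnections 𝔤 := by
  change (D.dDeg 1).rTensor 𝔤 (η ⊗ₜ g) + _ = 0
  rw [LinearMap.rTensor_tmul, hη, act_tmul, D.mulDeg_one_self]
  simp

theorem covDeriv_covDeriv {η : 𝒜 1} (hη : D.dDeg 1 η = 0) (g : 𝔤) (i : ℕ) (z : 𝒜 i ⊗[ℂ] V) :
    D.covDeriv θ (η ⊗ₜ g) (i + 1) (D.covDeriv θ (η ⊗ₜ g) i z) = 0 := by
  induction z using TensorProduct.induction_on with
  | zero => simp
  | add z w hz hw => rw [map_add, map_add, hz, hw, add_zero]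
  | tmul a v =>
    rw [covDeriv_tmul, map_add, covDeriv_tmul, covDeriv_tmul, D.dDeg_dDeg, D.dDeg_mulDeg hη,
      D.mulDeg_mulDeg_self, TensorProduct.neg_tmul]
    simp

/-- Contraction of the coefficients with a linear functional. -/
noncomputable def contractCoeff (f : Module.Dual ℂ V) (M : Type*) [AddCommGroup M] [Module ℂ M] :
    M ⊗[ℂ] V →ₗ[ℂ] M :=
  (TensorProduct.rid ℂ M).toLinearMap ∘ₗ f.lTensor M

@[simp]
theorem contractCoeff_tmul (f : Module.Dual ℂ V) {M : Type*} [AddCommGroup M] [Module ℂ M]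
    (m : M) (v : V) : contractCoeff f M (m ⊗ₜ v) = f v • m := by
  simp [contractCoeff]

/-- The error term involves `f ∘ θ(g)`, so a functional that kills the range of `θ(g)` turns `d_ω`
into `d`. -/
theorem contractCoeff_covDeriv (f : Module.Dual ℂ V) (η : 𝒜 1) (g : 𝔤) (i : ℕ) (z : 𝒜 i ⊗[ℂ] V) :
    contractCoeff f _ (D.covDeriv θ (η ⊗ₜ g) i z) =
      D.dDeg i (contractCoeff f _ z) + mulDeg 𝒜 i η (contractCoeff (f ∘ₗ θ g) _ z) := by
  induction z using TensorProduct.induction_on with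
  | zero => simp
  | add z w hz hw => simp only [map_add, hz, hw]; abel
  | tmul a v => simp [covDeriv_tmul]

/-- If `θ(g)` is singular, then the exactness of `A ⊗ V` in a degree, for the covariant derivative
of `η ⊗ g`, implies the exactness of `A`. -/
theorem ker_dDeg_le_of_ker_covDeriv_le [FiniteDimensional ℂ V] {η : 𝒜 1} {g : 𝔤}
    (hg : LinearMap.det (θ g) = 0) (i : ℕ)
    (h : LinearMap.ker (D.covDeriv θ (η ⊗ₜ g) i) ≤ coboundaries (D.covDeriv θ (η ⊗ₜ g)) i) :
    LinearMap.ker (D.dDeg i) ≤ coboundaries D.dDeg i := by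
  have hker : LinearMap.ker (θ g) ≠ ⊥ := (LinearMap.bot_lt_ker_of_det_eq_zero hg).ne'
  obtain ⟨v, hv, hv0⟩ := Submodule.exists_mem_ne_zero_of_ne_bot hker
  obtain ⟨f, hf⟩ : ∃ f : Module.Dual ℂ V, f v = 1 := Module.Projective.exists_dual_eq_one ℂ hv0
  have hclosed : ∀ (a : 𝒜 i), D.dDeg i a = 0 → ∀ w : V, (mulDeg 𝒜 i η a) ⊗ₜ[ℂ] θ g w = 0 →
      a ⊗ₜ[ℂ] w ∈ coboundaries (D.covDeriv θ (η ⊗ₜ g)) i := fun a ha w hw => h (by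
    rw [LinearMap.mem_ker, covDeriv_tmul, ha, hw]
    simp)
  have hv' : θ g v = 0 := hv
  intro a ha
  have h1 := hclosed a ha v (by rw [hv', TensorProduct.tmul_zero])
  cases i with
  | zero =>
    have h2 : a ⊗ₜ[ℂ] v = 0 := h1
    have h3 := congrArg (contractCoeff f _) h2
    rw [contractCoeff_tmul, hf, one_smul, map_zero] at h3
    rw [h3]
    exact Submodule.zero_mem _
  | succ i =>
    obtain ⟨y, hy⟩ := h1
    have h2 := congrArg (contractCoeff f _) hy
    rw [contractCoeff_covDeriv, contractCoeff_tmul, hf, one_smul] at h2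
    -- Up to a coboundary, `a` is a multiple of `η`, and `η` squares to zero. The new representative
    -- therefore gives a `d_ω`-cocycle with any coefficient vector, not only with one in `ker θ(g)`.
    have hηa : mulDeg 𝒜 (i + 1) η (a - D.dDeg i (contractCoeff f _ y)) = 0 := by
      rw [← h2, add_sub_cancel_left, D.mulDeg_mulDeg_self]
    have hda : D.dDeg (i + 1) (a - D.dDeg i (contractCoeff f _ y)) = 0 := by
      rw [map_sub, D.dDeg_dDeg, sub_zero]
      exact ha
    -- This freedom is spent on a vector `w` outside the range of `θ(g)`, detected by a functional
    -- `f'` that vanishes on that range.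
    have hrange : LinearMap.range (θ g) ≠ ⊤ := fun ht =>
      hker (LinearMap.ker_eq_bot_iff_range_eq_top.mpr ht)
    obtain ⟨f', hf'0, hf'⟩ := Submodule.exists_le_ker_of_lt_top _ (lt_top_iff_ne_top.mpr hrange)
    obtain ⟨w, hw⟩ : ∃ w, f' w = 1 := by
      obtain ⟨w, hw⟩ := LinearMap.surjective hf'0 1
      exact ⟨w, hw⟩
    obtain ⟨y', hy'⟩ := hclosed _ hda w (by rw [hηa, TensorProduct.zero_tmul])
    have hf'θ : f' ∘ₗ θ g = 0 := LinearMap.ext fun x => hf' (LinearMap.mem_range_self _ _)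
    have h3 := congrArg (contractCoeff f' _) hy'
    rw [contractCoeff_covDeriv, contractCoeff_tmul, hw, one_smul, hf'θ] at h3
    refine ⟨contractCoeff f' _ y' + contractCoeff f _ y, ?_⟩
    rw [map_add]
    have h4 : contractCoeff (0 : Module.Dual ℂ V) (𝒜 i) = 0 := by
      simp [contractCoeff]
    rw [h4, LinearMap.zero_apply, map_zero, add_zero] at h3
    rw [h3, sub_add_cancel]

theorem mem_resonance_one_iff (i : ℕ) (ω : 𝒜 1 ⊗[ℂ] 𝔤) :
    ω ∈ D.resonance θ i 1 ↔ ω ∈ D.flatConnections 𝔤 ∧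
      ¬ LinearMap.ker (D.covDeriv θ ω i) ≤ coboundaries (D.covDeriv θ ω) i := by
  rw [← subsingleton_cochainCohomology_iff, not_subsingleton_iff_nontrivial,
    ← rank_pos_iff_nontrivial (R := ℂ), ← Cardinal.one_le_iff_pos]
  simp [resonance]

/-- Exactness of `A` in a degree implies the exactness of `A ⊗ V` for the covariant derivatives
of small decomposable closed forms. -/
theorem eventually_ker_covDeriv_le [∀ i, FiniteDimensional ℂ (𝒜 i)] [FiniteDimensional ℂ V]
    (i : ℕ) (h : LinearMap.ker (D.dDeg i) ≤ coboundaries D.dDeg i) :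
    ∀ᶠ ω in nhdsZero (𝒜 1 ⊗[ℂ] 𝔤), ∀ (η : 𝒜 1) (g : 𝔤), D.dDeg 1 η = 0 → ω = η ⊗ₜ g →
      LinearMap.ker (D.covDeriv θ ω i) ≤ coboundaries (D.covDeriv θ ω) i := by
  cases i with
  | zero =>
    obtain ⟨t, ht⟩ := (D.dDeg 0).exists_leftInverse_of_injective (le_bot_iff.mp h)
    have hφ := eventually_det_add_ne_zero
      (LinearMap.compRight ℂ (t.rTensor V) ∘ₗ act 𝒜 θ 0) 1 (by simp)
    filter_upwards [hφ] with ω hω η g hη hωg z hz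
    have hinj : Function.Injective ((1 : Module.End ℂ (𝒜 0 ⊗[ℂ] V)) +
        (LinearMap.compRight ℂ (t.rTensor V) ∘ₗ act 𝒜 θ 0) ω) :=
      LinearMap.injective_of_det_ne_zero hω
    -- In degree `0` there are no coboundaries, and a left inverse of `d` replaces the homotopy.
    have h1 : (1 : Module.End ℂ (𝒜 0 ⊗[ℂ] V)) +
        (LinearMap.compRight ℂ (t.rTensor V) ∘ₗ act 𝒜 θ 0) ω =
        t.rTensor V ∘ₗ D.covDeriv θ ω 0 := by
      rw [covDeriv, LinearMap.comp_add, ← LinearMap.rTensor_comp, ht, LinearMap.rTensor_id]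
      rfl
    rw [h1] at hinj
    have hz' : D.covDeriv θ ω 0 z = 0 := hz
    exact hinj (by simp [hz'])
  | succ i =>
    obtain ⟨s, t, hst⟩ := exists_splitting D.dDeg i h
    have hφ := eventually_det_add_ne_zero
      (LinearMap.lcomp ℂ _ (s.rTensor V) ∘ₗ act 𝒜 θ i +
        LinearMap.compRight ℂ (t.rTensor V) ∘ₗ act 𝒜 θ (i + 1)) 1 (by simp)
    filter_upwards [hφ] with ω hω η g hη hωg
    -- From `d s + t d = 1` the twisted homotopy is `1` plus a term linear in `ω`.
    have h1 : (1 : Module.End ℂ (𝒜 (i + 1) ⊗[ℂ] V)) +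
        (LinearMap.lcomp ℂ _ (s.rTensor V) ∘ₗ act 𝒜 θ i +
          LinearMap.compRight ℂ (t.rTensor V) ∘ₗ act 𝒜 θ (i + 1)) ω =
        D.covDeriv θ ω i ∘ₗ s.rTensor V + t.rTensor V ∘ₗ D.covDeriv θ ω (i + 1) := by
      rw [covDeriv, covDeriv, LinearMap.comp_add, LinearMap.add_comp, ← LinearMap.rTensor_comp,
        ← LinearMap.rTensor_comp, add_add_add_comm, ← LinearMap.rTensor_add, hst,
        LinearMap.rTensor_id]
      rfl
    have hinj := LinearMap.injective_of_det_ne_zero hω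
    rw [h1] at hinj
    refine Submodule.le_of_injective_of_mapsTo ?_ _ hinj fun z hz => ?_
    · subst hωg
      exact coboundaries_le_ker _ (D.covDeriv_covDeriv θ hη g) (i + 1)
    · have hz' : D.covDeriv θ ω (i + 1) z = 0 := hz
      refine ⟨s.rTensor V z, ?_⟩
      simp [hz']

end CDGA

/-! ### Contraction on the Chevalley–Eilenberg algebra -/

namespace ChevalleyEilenberg

open CDGA

variable {𝔥 : Type*} [LieRing 𝔥] [LieAlgebra ℂ 𝔥]

/-- The interior product with an element of `𝔥`. -/
noncomputable def contract (x : 𝔥) : Alg 𝔥 →ₗ[ℂ] Alg 𝔥 :=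
  CliffordAlgebra.contractLeft (Q := 0) (Module.Dual.eval ℂ 𝔥 x)

theorem contract_ι (x : 𝔥) (φ : Module.Dual ℂ 𝔥) :
    contract x (ExteriorAlgebra.ι ℂ φ) = algebraMap ℂ _ (φ x) :=
  CliffordAlgebra.contractLeft_ι _ _ φ

theorem contract_ι_mul (x : 𝔥) (φ : Module.Dual ℂ 𝔥) (a : Alg 𝔥) :
    contract x (ExteriorAlgebra.ι ℂ φ * a) = φ x • a - ExteriorAlgebra.ι ℂ φ * contract x a :=
  CliffordAlgebra.contractLeft_ι_mul _ _ a

theorem contract_algebraMap (x : 𝔥) (r : ℂ) : contract x (algebraMap ℂ (Alg 𝔥) r) = 0 :=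
  CliffordAlgebra.contractLeft_algebraMap _ _ r

theorem contract_of_mem_zero (x : 𝔥) {a : Alg 𝔥} (ha : a ∈ grading 𝔥 0) : contract x a = 0 := by
  change a ∈ (LinearMap.range (ExteriorAlgebra.ι ℂ)) ^ 0 at ha
  rw [pow_zero] at ha
  obtain ⟨r, rfl⟩ := Submodule.mem_one.mp ha
  exact contract_algebraMap x r

theorem contract_mem_pred (x : 𝔥) {n : ℕ} {a : Alg 𝔥} (ha : a ∈ grading 𝔥 n) :
    contract x a ∈ grading 𝔥 (n - 1) := by
  induction ha using Submodule.pow_induction_on_left' with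
  | algebraMap r =>
    rw [contract_algebraMap]
    exact Submodule.zero_mem _
  | add a b i _ _ iha ihb =>
    rw [map_add]
    exact Submodule.add_mem _ iha ihb
  | mem_mul m hm i a ha ih =>
    obtain ⟨φ, rfl⟩ := hm
    rw [contract_ι_mul]
    refine Submodule.sub_mem _ (Submodule.smul_mem _ _ ha) ?_
    -- The degree `n - 1` is truncated at `0`; this does no harm because contraction kills degree
    -- `0`.
    cases i with
    | zero =>
      rw [contract_of_mem_zero x ha, mul_zero]
      exact Submodule.zero_mem _
    | succ i =>
      change _ ∈ (LinearMap.range (ExteriorAlgebra.ι ℂ)) ^ (i + 1)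
      rw [pow_succ']
      exact Submodule.mul_mem_mul (LinearMap.mem_range_self _ _) ih

/-- The interior product in degree `i + 1`. -/
noncomputable def contractDeg (x : 𝔥) (i : ℕ) : grading 𝔥 (i + 1) →ₗ[ℂ] grading 𝔥 i :=
  (contract x).restrict fun _ ha => contract_mem_pred x ha

variable (𝔥) in
/-- The forms of degree one are the linear functionals. -/
noncomputable def dualEquiv : Module.Dual ℂ 𝔥 ≃ₗ[ℂ] grading 𝔥 1 :=
  (LinearEquiv.ofInjective (ExteriorAlgebra.ι ℂ) ExteriorAlgebra.ι_leftInverse.injective).trans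
    (LinearEquiv.ofEq _ _ (pow_one _).symm)

theorem coe_dualEquiv (φ : Module.Dual ℂ 𝔥) :
    (dualEquiv 𝔥 φ : Alg 𝔥) = ExteriorAlgebra.ι ℂ φ := rfl

theorem coe_eq_ι (η : grading 𝔥 1) : (η : Alg 𝔥) = ExteriorAlgebra.ι ℂ ((dualEquiv 𝔥).symm η) := by
  rw [← coe_dualEquiv, LinearEquiv.apply_symm_apply]

theorem contractDeg_mulDeg_zero (x : 𝔥) (η : grading 𝔥 1) (a : grading 𝔥 0) :
    contractDeg x 0 (mulDeg (grading 𝔥) 0 η a) = (dualEquiv 𝔥).symm η x • a := by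
  refine Subtype.ext ?_
  change contract x ((η : Alg 𝔥) * (a : Alg 𝔥)) = (dualEquiv 𝔥).symm η x • (a : Alg 𝔥)
  rw [coe_eq_ι, contract_ι_mul, contract_of_mem_zero x a.2, mul_zero, sub_zero]

theorem contractDeg_mulDeg (x : 𝔥) (i : ℕ) (η : grading 𝔥 1) (a : grading 𝔥 (i + 1)) :
    contractDeg x (i + 1) (mulDeg (grading 𝔥) (i + 1) η a) =
      (dualEquiv 𝔥).symm η x • a - mulDeg (grading 𝔥) i η (contractDeg x i a) := by
  refine Subtype.ext ?_
  change contract x ((η : Alg 𝔥) * (a : Alg 𝔥)) =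
    (dualEquiv 𝔥).symm η x • (a : Alg 𝔥) - (η : Alg 𝔥) * contract x (a : Alg 𝔥)
  rw [coe_eq_ι, contract_ι_mul]

variable [FiniteDimensional ℂ 𝔥]

/-- Contraction antisymmetrizes each product of generators; skewness of the Lie bracket makes the
two halves equal, which absorbs the factor `1 / 2` in `dGen`. -/
theorem contract_contract_dGen (x y : 𝔥) (φ : Module.Dual ℂ 𝔥) :
    contract y (contract x (dGen 𝔥 φ)) = algebraMap ℂ _ (-φ ⁅x, y⁆) := by
  have hg : ∀ i j, contract y (contract x (gen 𝔥 i * gen 𝔥 j)) =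
      algebraMap ℂ _ ((Module.finBasis ℂ 𝔥).coord i x * (Module.finBasis ℂ 𝔥).coord j y -
        (Module.finBasis ℂ 𝔥).coord i y * (Module.finBasis ℂ 𝔥).coord j x) := fun i j => by
    rw [gen, gen, contract_ι_mul, contract_ι, map_sub, map_smul, contract_ι, ← Algebra.commutes,
      ← Algebra.smul_def, map_smul, contract_ι, map_sub, map_mul, map_mul, Algebra.smul_def,
      Algebra.smul_def, Algebra.commutes ((Module.finBasis ℂ 𝔥).coord j x)]
  have hφ : ∀ x y, φ ⁅x, y⁆ = ∑ i, ∑ j, φ ⁅Module.finBasis ℂ 𝔥 i, Module.finBasis ℂ 𝔥 j⁆ *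
      ((Module.finBasis ℂ 𝔥).coord i x * (Module.finBasis ℂ 𝔥).coord j y) := fun x y => by
    conv_lhs => rw [← (Module.finBasis ℂ 𝔥).sum_repr x, ← (Module.finBasis ℂ 𝔥).sum_repr y]
    simp only [sum_lie, lie_sum, smul_lie, lie_smul, map_sum, map_smul, smul_eq_mul,
      Module.Basis.coord_apply, Finset.mul_sum]
    rw [Finset.sum_comm]
    refine Finset.sum_congr rfl fun i _ => Finset.sum_congr rfl fun j _ => ?_
    ring
  have hskew : φ ⁅x, y⁆ = -φ ⁅y, x⁆ := by rw [← lie_skew, map_neg]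
  rw [dGen_apply, map_smul, map_smul]
  simp only [map_sum, map_smul, hg]
  simp only [Algebra.algebraMap_eq_smul_one, smul_smul, ← Finset.sum_smul]
  congr 1
  simp only [mul_sub, Finset.sum_sub_distrib]
  rw [← hφ, ← hφ]
  linear_combination (1 / 2 : ℂ) * hskew

theorem contractDeg_dDeg_one (x y : 𝔥) (η : grading 𝔥 1) :
    (dualEquiv 𝔥).symm (contractDeg x 1 ((cdga 𝔥).dDeg 1 η)) y =
      -(dualEquiv 𝔥).symm η ⁅x, y⁆ := by
  refine (algebraMap ℂ (Alg 𝔥)).injective ?_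
  rw [← contract_ι, ← coe_eq_ι]
  change contract y (contract x (d 𝔥 (η : Alg 𝔥))) = _
  rw [coe_eq_ι η, d_ι, contract_contract_dGen]

/-! ### One-forms with values in a Lie algebra -/

variable {𝔤 : Type*} [LieRing 𝔤] [LieAlgebra ℂ 𝔤] {V : Type*} [AddCommGroup V] [Module ℂ V]

variable (𝔥 𝔤) in
/-- The identification of `A¹ ⊗ 𝔤` with the space of linear maps from `𝔥` to `𝔤`. -/
noncomputable def toHom : grading 𝔥 1 ⊗[ℂ] 𝔤 ≃ₗ[ℂ] (𝔥 →ₗ[ℂ] 𝔤) :=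
  (TensorProduct.congr (dualEquiv 𝔥).symm (LinearEquiv.refl ℂ 𝔤)).trans
    (dualTensorHomEquiv ℂ 𝔥 𝔤)

theorem toHom_zero : toHom 𝔥 𝔤 0 = 0 := LinearEquiv.map_zero _

theorem toHom_sub (ω ω' : grading 𝔥 1 ⊗[ℂ] 𝔤) :
    toHom 𝔥 𝔤 (ω - ω') = toHom 𝔥 𝔤 ω - toHom 𝔥 𝔤 ω' := map_sub (toHom 𝔥 𝔤).toLinearMap ω ω'

theorem toHom_tmul (η : grading 𝔥 1) (g : 𝔤) (x : 𝔥) :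
    toHom 𝔥 𝔤 (η ⊗ₜ g) x = (dualEquiv 𝔥).symm η x • g := by
  simp [toHom, dualTensorHomEquiv]

theorem contractDeg_act_zero (θ : 𝔤 →ₗ⁅ℂ⁆ Module.End ℂ V) (ω : grading 𝔥 1 ⊗[ℂ] 𝔤) (x : 𝔥)
    (z : grading 𝔥 0 ⊗[ℂ] V) :
    (contractDeg x 0).rTensor V (act (grading 𝔥) θ 0 ω z) =
      (θ (toHom 𝔥 𝔤 ω x)).lTensor (grading 𝔥 0) z := by
  induction ω using TensorProduct.induction_on with
  | zero => simp [toHom_zero]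
  | add ω ω' h h' =>
    simp only [map_add, LinearMap.add_apply, h, h', LinearMap.lTensor_add]
  | tmul η g =>
    induction z using TensorProduct.induction_on with
    | zero => simp
    | add z w hz hw => simp only [map_add, hz, hw]
    | tmul a v =>
      rw [act_tmul, LinearMap.rTensor_tmul, contractDeg_mulDeg_zero, LinearMap.lTensor_tmul,
        toHom_tmul, map_smul, LinearMap.smul_apply, TensorProduct.smul_tmul]

/-- Contraction is an antiderivation, and contracting `ω` itself with `x` evaluates it at `x`. -/
theorem contractDeg_act (θ : 𝔤 →ₗ⁅ℂ⁆ Module.End ℂ V) (ω : grading 𝔥 1 ⊗[ℂ] 𝔤) (x : 𝔥) (i : ℕ)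
    (z : grading 𝔥 (i + 1) ⊗[ℂ] V) :
    (contractDeg x (i + 1)).rTensor V (act (grading 𝔥) θ (i + 1) ω z) =
      (θ (toHom 𝔥 𝔤 ω x)).lTensor (grading 𝔥 (i + 1)) z -
        act (grading 𝔥) θ i ω ((contractDeg x i).rTensor V z) := by
  induction ω using TensorProduct.induction_on with
  | zero => simp [toHom_zero]
  | add ω ω' h h' =>
    simp only [map_add, LinearMap.add_apply, h, h', LinearMap.lTensor_add]
    abel
  | tmul η g =>
    induction z using TensorProduct.induction_on with
    | zero => simp
    | add z w hz hw =>
      simp only [map_add, hz, hw]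
      abel
    | tmul a v =>
      rw [act_tmul, LinearMap.rTensor_tmul, contractDeg_mulDeg, LinearMap.lTensor_tmul,
        toHom_tmul, map_smul, LinearMap.smul_apply, TensorProduct.sub_tmul,
        TensorProduct.smul_tmul]
      rfl

/-- Contract the Maurer–Cartan equation with `x`, then evaluate at `y`: `dω` gives `-ω([x, y])`, and
`[ω, ω]` gives `[ω(x), ω(y)]` twice. -/
theorem toHom_lie {ω : grading 𝔥 1 ⊗[ℂ] 𝔤} (hω : ω ∈ (cdga 𝔥).flatConnections 𝔤) (x y : 𝔥) :
    toHom 𝔥 𝔤 ω ⁅x, y⁆ = ⁅toHom 𝔥 𝔤 ω x, toHom 𝔥 𝔤 ω y⁆ := by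
  have hd : ∀ ω : grading 𝔥 1 ⊗[ℂ] 𝔤, toHom 𝔥 𝔤 ((contractDeg x 1).rTensor 𝔤
      (((cdga 𝔥).dDeg 1).rTensor 𝔤 ω)) y = -toHom 𝔥 𝔤 ω ⁅x, y⁆ := fun ω => by
    induction ω using TensorProduct.induction_on with
    | zero => simp [toHom_zero]
    | add ω ω' h h' =>
      simp only [map_add, LinearMap.add_apply, h, h']
      abel
    | tmul η g =>
      rw [LinearMap.rTensor_tmul, LinearMap.rTensor_tmul, toHom_tmul, toHom_tmul,
        contractDeg_dDeg_one, neg_smul]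
  have hl : ∀ (u : 𝔤) (ω : grading 𝔥 1 ⊗[ℂ] 𝔤),
      toHom 𝔥 𝔤 ((LieAlgebra.ad ℂ 𝔤 u).lTensor (grading 𝔥 1) ω) y = ⁅u, toHom 𝔥 𝔤 ω y⁆ := by
    intro u ω
    induction ω using TensorProduct.induction_on with
    | zero => simp [toHom_zero]
    | add ω ω' h h' => simp only [map_add, LinearMap.add_apply, h, h', lie_add]
    | tmul η g => simp [toHom_tmul]
  have hr : ∀ ω ω' : grading 𝔥 1 ⊗[ℂ] 𝔤, toHom 𝔥 𝔤 (act (grading 𝔥) (LieAlgebra.ad ℂ 𝔤) 0 ω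
      ((contractDeg x 0).rTensor 𝔤 ω')) y = ⁅toHom 𝔥 𝔤 ω y, toHom 𝔥 𝔤 ω' x⁆ := by
    intro ω ω'
    induction ω using TensorProduct.induction_on with
    | zero => simp [toHom_zero]
    | add ω₁ ω₂ h h' => simp only [map_add, LinearMap.add_apply, h, h', add_lie]
    | tmul η g =>
      induction ω' using TensorProduct.induction_on with
      | zero => simp [toHom_zero]
      | add ω₁ ω₂ h h' => simp only [map_add, LinearMap.add_apply, h, h', lie_add]
      | tmul η' g' =>
        have h : mulDeg (grading 𝔥) 0 η (contractDeg x 0 η') = (dualEquiv 𝔥).symm η' x • η := by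
          refine Subtype.ext ?_
          change (η : Alg 𝔥) * contract x (η' : Alg 𝔥) = (dualEquiv 𝔥).symm η' x • (η : Alg 𝔥)
          rw [coe_eq_ι η', contract_ι, ← Algebra.commutes, ← Algebra.smul_def]
        rw [LinearMap.rTensor_tmul, act_tmul, h]
        simp [smul_smul, toHom_tmul]
  have h := congrArg (fun z => toHom 𝔥 𝔤 ((contractDeg x 1).rTensor 𝔤 z) y) hω
  simp only [map_add, map_smul, map_zero, LinearMap.add_apply, LinearMap.smul_apply,
    LinearMap.zero_apply, hd] at h
  rw [contractDeg_act, toHom_sub, LinearMap.sub_apply, hl, hr, ← lie_skew (toHom 𝔥 𝔤 ω y),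
    sub_neg_eq_add, ← two_smul ℂ, smul_smul] at h
  norm_num at h
  rw [neg_add_eq_zero] at h
  exact h

end ChevalleyEilenberg

namespace ChevalleyEilenberg

open CDGA

variable {𝔥 : Type*} [LieRing 𝔥] [LieAlgebra ℂ 𝔥] [FiniteDimensional ℂ 𝔥]

/-! ### Flat connections near the origin -/

/-- The homomorphism carries the cubic identity of `sl₂` back to `𝔥`. The eigenvector is the
functional `z ↦ f(ρ([x, z]))`, which is nonzero because `f` is chosen to be `1` on the given
bracket. -/
theorem hasEigenvalue_of_lie_ne_zero {ω : grading 𝔥 1 ⊗[ℂ] sl₂}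
    (hω : ω ∈ (cdga 𝔥).flatConnections sl₂) {x y : 𝔥}
    (h : ⁅toHom 𝔥 sl₂ ω x, toHom 𝔥 sl₂ ω y⁆ ≠ 0) :
    Module.End.HasEigenvalue (Module.Dual.transpose (R := ℂ) (LieAlgebra.ad ℂ 𝔥 x ^ 2))
      (-4 * (toHom 𝔥 sl₂ ω x).1.det) := by
  obtain ⟨f, hf⟩ := Module.Projective.exists_dual_eq_one ℂ h
  refine Module.End.hasEigenvalue_of_hasEigenvector
    (x := f ∘ₗ toHom 𝔥 sl₂ ω ∘ₗ LieAlgebra.ad ℂ 𝔥 x) ⟨?_, fun h0 => ?_⟩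
  · rw [Module.End.mem_eigenspace_iff]
    refine LinearMap.ext fun z => ?_
    change f (toHom 𝔥 sl₂ ω ⁅x, (LieAlgebra.ad ℂ 𝔥 x ^ 2) z⁆) = _ * f (toHom 𝔥 sl₂ ω ⁅x, z⁆)
    rw [pow_two, Module.End.mul_apply, LieAlgebra.ad_apply, LieAlgebra.ad_apply, toHom_lie hω,
      toHom_lie hω, toHom_lie hω, sl₂.lie_lie_lie, map_smul, smul_eq_mul]
  · have h1 := LinearMap.congr_fun h0 y
    change f (toHom 𝔥 sl₂ ω ⁅x, y⁆) = 0 at h1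
    rw [toHom_lie hω, hf] at h1
    exact one_ne_zero h1

theorem eventually_det_eq_zero_or (x : 𝔥) :
    ∀ᶠ ω in nhdsZero (grading 𝔥 1 ⊗[ℂ] sl₂), ω ∈ (cdga 𝔥).flatConnections sl₂ →
      (toHom 𝔥 sl₂ ω x).1.det = 0 ∨ ∀ y, ⁅toHom 𝔥 sl₂ ω x, toHom 𝔥 sl₂ ω y⁆ = 0 := by
  have hdet := tendsto_det_nhdsZero
    ((LieAlgebra.SpecialLinear.sl (Fin 2) ℂ).toSubmodule.subtype ∘ₗ LinearMap.applyₗ x ∘ₗ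
      (toHom 𝔥 sl₂).toLinearMap) 0
  simp only [zero_add] at hdet
  rw [Matrix.det_zero] at hdet
  have hdet4 := hdet.const_mul (-4 : ℂ)
  rw [mul_zero] at hdet4
  -- The nonzero eigenvalues form a finite set independent of `ω`, so their complement is a
  -- neighbourhood of `0`, which `-4 det ρ(x)` enters as `ω → 0`.
  have hfin := (Module.End.finite_hasEigenvalue (Module.Dual.transpose (R := ℂ)
    (LieAlgebra.ad ℂ 𝔥 x ^ 2))).subset (Set.sdiff_subset (t := {0}))
  have h0 : (0 : ℂ) ∈ ({μ | Module.End.HasEigenvalue (Module.Dual.transpose (R := ℂ)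
    (LieAlgebra.ad ℂ 𝔥 x ^ 2)) μ} \ {0})ᶜ := by simp
  filter_upwards [hdet4 (hfin.isClosed.isOpen_compl.mem_nhds h0)] with ω h hω
  by_contra! hne
  obtain ⟨hd, y, hy⟩ := hne
  exact h ⟨hasEigenvalue_of_lie_ne_zero hω hy, mul_ne_zero (by norm_num) hd⟩

/-- Centralizers in `sl₂` are lines, so the image is spanned by one value `g = ρ(x)`. The quadratic
term then vanishes and flatness reduces to `dη ⊗ g = 0`. -/
theorem exists_eq_tmul_of_commute {ω : grading 𝔥 1 ⊗[ℂ] sl₂}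
    (hω : ω ∈ (cdga 𝔥).flatConnections sl₂)
    (h : ∀ x y, ⁅toHom 𝔥 sl₂ ω x, toHom 𝔥 sl₂ ω y⁆ = 0) :
    ∃ (η : grading 𝔥 1) (g : sl₂), (cdga 𝔥).dDeg 1 η = 0 ∧ ω = η ⊗ₜ g := by
  by_cases h0 : ∃ x, toHom 𝔥 sl₂ ω x ≠ 0
  · obtain ⟨x, hx⟩ := h0
    obtain ⟨f, hf⟩ := Module.Projective.exists_dual_eq_one ℂ hx
    have heq : ω = dualEquiv 𝔥 (f ∘ₗ toHom 𝔥 sl₂ ω) ⊗ₜ toHom 𝔥 sl₂ ω x := by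
      refine (toHom 𝔥 sl₂).injective (LinearMap.ext fun y => ?_)
      rw [toHom_tmul, LinearEquiv.symm_apply_apply]
      obtain ⟨c, hc⟩ := sl₂.exists_smul_of_lie_eq_zero hx (h x y)
      rw [LinearMap.comp_apply, hc, map_smul, hf, smul_eq_mul, mul_one]
    refine ⟨_, _, ?_, heq⟩
    have hflat : ((cdga 𝔥).dDeg 1).rTensor sl₂ ω +
        (1 / 2 : ℂ) • act (grading 𝔥) (LieAlgebra.ad ℂ sl₂) 1 ω ω = 0 := hω
    rw [heq, act_tmul, (cdga 𝔥).mulDeg_one_self, TensorProduct.zero_tmul, smul_zero, add_zero,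
      LinearMap.rTensor_tmul] at hflat
    have h1 := congrArg (contractCoeff f _) hflat
    rwa [contractCoeff_tmul, hf, one_smul, map_zero] at h1
  · push Not at h0
    refine ⟨0, 0, map_zero _, (toHom 𝔥 sl₂).injective (LinearMap.ext fun y => ?_)⟩
    rw [h0, toHom_tmul, smul_zero]

theorem eventually_exists_eq_tmul :
    ∀ᶠ ω in nhdsZero (grading 𝔥 1 ⊗[ℂ] sl₂), ω ∈ (cdga 𝔥).flatConnections sl₂ →
      ∃ (η : grading 𝔥 1) (g : sl₂), (cdga 𝔥).dDeg 1 η = 0 ∧ ω = η ⊗ₜ g := by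
  let b := Module.finBasis ℂ 𝔥
  have h1 := Filter.eventually_all.mpr fun i => eventually_det_eq_zero_or (b i)
  -- Only finitely many smallness conditions may be intersected, so they are imposed on basis
  -- vectors and, for the polarization, on their pairwise sums.
  have h2 := Filter.eventually_all.mpr fun i =>
    Filter.eventually_all.mpr fun j => eventually_det_eq_zero_or (b i + b j)
  filter_upwards [h1, h2] with ω h1 h2 hω
  refine exists_eq_tmul_of_commute hω ?_
  by_contra hne
  -- A nonzero central element would put the whole image on its centralizer, a line, contradicting
  -- noncommutativity.
  have hdet : ∀ x, ((toHom 𝔥 sl₂ ω x).1.det = 0 ∨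
      ∀ y, ⁅toHom 𝔥 sl₂ ω x, toHom 𝔥 sl₂ ω y⁆ = 0) → (toHom 𝔥 sl₂ ω x).1.det = 0 := by
    rintro x (hx | hx)
    · exact hx
    · by_cases hx0 : toHom 𝔥 sl₂ ω x = 0
      · rw [hx0]
        exact Matrix.det_zero
      · refine (hne fun y z => ?_).elim
        obtain ⟨c, hc⟩ := sl₂.exists_smul_of_lie_eq_zero hx0 (hx y)
        rw [hc, smul_lie, hx, smul_zero]
  have hb : ∀ i j, ⁅toHom 𝔥 sl₂ ω (b i), toHom 𝔥 sl₂ ω (b j)⁆ = 0 := fun i j => by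
    refine sl₂.lie_eq_zero_of_det (hdet _ (h1 i hω)) (hdet _ (h1 j hω)) ?_
    rw [← map_add]
    exact hdet _ (h2 i j hω)
  have hb' : ∀ i y, ⁅toHom 𝔥 sl₂ ω (b i), toHom 𝔥 sl₂ ω y⁆ = 0 := fun i =>
    LinearMap.congr_fun (f := LieAlgebra.ad ℂ sl₂ (toHom 𝔥 sl₂ ω (b i)) ∘ₗ toHom 𝔥 sl₂ ω) (g := 0)
      (b.ext fun j => hb i j)
  refine hne fun x => LinearMap.congr_fun
    (f := LieAlgebra.ad ℂ sl₂ (toHom 𝔥 sl₂ ω x) ∘ₗ toHom 𝔥 sl₂ ω) (g := 0) (b.ext fun j => ?_)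
  change ⁅toHom 𝔥 sl₂ ω x, toHom 𝔥 sl₂ ω (b j)⁆ = 0
  rw [← lie_skew, hb', neg_zero]

/-! ### The Cartan homotopy -/

/-- The Lie derivative in degree `i`. -/
noncomputable def lieDerivDeg (x : 𝔥) : ∀ i, Module.End ℂ (grading 𝔥 i)
  | 0 => contractDeg x 0 ∘ₗ (cdga 𝔥).dDeg 0
  | i + 1 => (cdga 𝔥).dDeg i ∘ₗ contractDeg x i + contractDeg x (i + 1) ∘ₗ (cdga 𝔥).dDeg (i + 1)

variable {𝔤 : Type*} [LieRing 𝔤] [LieAlgebra ℂ 𝔤] {V : Type*} [AddCommGroup V] [Module ℂ V]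

/-- Cartan's formula `d_ω ι_x + ι_x d_ω = L_x ⊗ 1 + 1 ⊗ θ(ω(x))`, applied to a cocycle. The
`ω`-terms cancel except for the value at `x`; flatness plays no role. -/
theorem lieDeriv_mem_coboundaries (θ : 𝔤 →ₗ⁅ℂ⁆ Module.End ℂ V) (ω : grading 𝔥 1 ⊗[ℂ] 𝔤) (x : 𝔥)
    (i : ℕ) (z : grading 𝔥 i ⊗[ℂ] V) (hz : (cdga 𝔥).covDeriv θ ω i z = 0) :
    ((lieDerivDeg x i).rTensor V + (θ (toHom 𝔥 𝔤 ω x)).lTensor (grading 𝔥 i)) z ∈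
      coboundaries ((cdga 𝔥).covDeriv θ ω) i := by
  cases i with
  | zero =>
    have h := congrArg ((contractDeg x 0).rTensor V) hz
    rw [covDeriv, LinearMap.add_apply, map_add, contractDeg_act_zero, map_zero] at h
    change _ = 0
    rw [LinearMap.add_apply, lieDerivDeg, LinearMap.rTensor_comp]
    exact h
  | succ i =>
    have h := congrArg ((contractDeg x (i + 1)).rTensor V) hz
    rw [covDeriv, LinearMap.add_apply, map_add, contractDeg_act, map_zero] at h
    refine ⟨(contractDeg x i).rTensor V z, ?_⟩
    rw [covDeriv, LinearMap.add_apply, LinearMap.add_apply, lieDerivDeg, LinearMap.rTensor_add,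
      LinearMap.rTensor_comp, LinearMap.rTensor_comp, LinearMap.add_apply, LinearMap.comp_apply,
      LinearMap.comp_apply, ← sub_eq_zero, ← neg_eq_zero, ← h]
    abel

theorem eventually_ker_covDeriv_le_of_det_ne_zero [FiniteDimensional ℂ V]
    (θ : 𝔤 →ₗ⁅ℂ⁆ Module.End ℂ V) (i : ℕ) :
    ∀ᶠ ω in nhdsZero (grading 𝔥 1 ⊗[ℂ] 𝔤), ∀ (η : grading 𝔥 1) (g : 𝔤),
      (cdga 𝔥).dDeg 1 η = 0 → ω = η ⊗ₜ g → ω ≠ 0 → LinearMap.det (θ g) ≠ 0 →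
      LinearMap.ker ((cdga 𝔥).covDeriv θ ω i) ≤ coboundaries ((cdga 𝔥).covDeriv θ ω) i := by
  let b := Module.finBasis ℂ 𝔥
  -- `L_x` is independent of `ω`, so only finitely many `μ` occur; for each nonzero one, `μ +
  -- θ(ω(x))` is a small perturbation of an invertible scalar.
  have hev : ∀ k, ∀ᶠ ω in nhdsZero (grading 𝔥 1 ⊗[ℂ] 𝔤),
      ∀ μ ∈ {μ | (lieDerivDeg (b k) i).HasEigenvalue μ}, μ ≠ 0 →
        LinearMap.det (μ • (1 : Module.End ℂ V) + θ (toHom 𝔥 𝔤 ω (b k))) ≠ 0 := fun k => by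
    rw [Filter.eventually_all_finite (Module.End.finite_hasEigenvalue _)]
    intro μ _
    by_cases hμ : μ = 0
    · simp [hμ]
    · have h := eventually_det_add_ne_zero ((θ : 𝔤 →ₗ[ℂ] Module.End ℂ V) ∘ₗ
        LinearMap.applyₗ (b k) ∘ₗ (toHom 𝔥 𝔤).toLinearMap) (μ • (1 : Module.End ℂ V))
        (by rw [LinearMap.det_smul]; simp [hμ])
      filter_upwards [h] with ω hω _
      exact hω
  filter_upwards [Filter.eventually_all.mpr hev] with ω hω η g hη hωg hω0 hg
  obtain ⟨k, hk⟩ : ∃ k, (dualEquiv 𝔥).symm η (b k) ≠ 0 := by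
    by_contra! hall
    have h0 : (dualEquiv 𝔥).symm η = 0 := b.ext hall
    rw [LinearEquiv.map_eq_zero_iff] at h0
    exact hω0 (by rw [hωg, h0, TensorProduct.zero_tmul])
  refine Submodule.le_of_injective_of_mapsTo ?_
    ((lieDerivDeg (b k) i).rTensor V + (θ (toHom 𝔥 𝔤 ω (b k))).lTensor (grading 𝔥 i)) ?_
    fun z hz => lieDeriv_mem_coboundaries θ ω (b k) i z hz
  · subst hωg
    exact coboundaries_le_ker _ ((cdga 𝔥).covDeriv_covDeriv θ hη g) i
  · refine injective_rTensor_add_lTensor _ _ fun μ hT hL => ?_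
    obtain ⟨v, hv⟩ := hT.exists_hasEigenvector
    have hTv := hv.apply_eq_smul
    -- Here `θ(ω(x)) = η(x) θ(g)` is invertible. This excludes the eigenvalue `0` of `L_x`, the one
    -- that smallness cannot handle.
    have hμ : μ ≠ 0 := by
      rintro rfl
      rw [hωg, toHom_tmul, map_smul, LinearMap.smul_apply, zero_smul] at hTv
      exact hv.2 (LinearMap.injective_of_det_ne_zero hg
        (by rw [(smul_eq_zero.mp hTv).resolve_left hk, map_zero]))
    refine hv.2 (LinearMap.injective_of_det_ne_zero (hω k (-μ) hL (neg_ne_zero.mpr hμ)) ?_)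
    rw [LinearMap.add_apply, hTv, map_zero, LinearMap.smul_apply, Module.End.one_apply, neg_smul,
      neg_add_cancel]

/-! ### Resonance near the origin -/

theorem det_map_zero [FiniteDimensional ℂ V] [Nontrivial V] (θ : 𝔤 →ₗ⁅ℂ⁆ Module.End ℂ V) :
    LinearMap.det (θ 0) = 0 := by
  rw [map_zero, LinearMap.det_zero, zero_pow Module.finrank_pos.ne']

theorem eventually_mem_resonance_iff [FiniteDimensional ℂ V] [Nontrivial V]
    (θ : sl₂ →ₗ⁅ℂ⁆ Module.End ℂ V) (i : ℕ) (hi : Nontrivial ((cdga 𝔥).H i)) :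
    ∀ᶠ ω in nhdsZero (grading 𝔥 1 ⊗[ℂ] sl₂), ω ∈ (cdga 𝔥).resonance θ i 1 ↔
      ∃ (η : grading 𝔥 1) (g : sl₂), (cdga 𝔥).dDeg 1 η = 0 ∧ ω = η ⊗ₜ g ∧
        LinearMap.det (θ g) = 0 := by
  rw [← not_subsingleton_iff_nontrivial, subsingleton_cochainCohomology_iff] at hi
  filter_upwards [eventually_exists_eq_tmul, eventually_ker_covDeriv_le_of_det_ne_zero θ i]
    with ω h1 h2
  rw [mem_resonance_one_iff]
  constructor
  · rintro ⟨hω, hne⟩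
    -- At the origin the witness is `g = 0`, whose determinant vanishes because `V ≠ 0`.
    by_cases h0 : ω = 0
    · refine ⟨0, 0, map_zero _, by rw [h0, TensorProduct.zero_tmul], ?_⟩
      rw [map_zero, LinearMap.det_zero, zero_pow Module.finrank_pos.ne']
    · obtain ⟨η, g, hη, hωg⟩ := h1 hω
      refine ⟨η, g, hη, hωg, ?_⟩
      by_contra hg
      exact hne (h2 η g hη hωg h0 hg)
  · rintro ⟨η, g, hη, rfl, hg⟩
    exact ⟨(cdga 𝔥).tmul_mem_flatConnections hη g,
      fun hle => hi ((cdga 𝔥).ker_dDeg_le_of_ker_covDeriv_le θ hg i hle)⟩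

theorem germEq_resonance_empty [FiniteDimensional ℂ V]
    (θ : sl₂ →ₗ⁅ℂ⁆ Module.End ℂ V) (i : ℕ) (hi : Subsingleton ((cdga 𝔥).H i)) :
    GermEq ((cdga 𝔥).resonance θ i 1) ∅ := by
  rw [subsingleton_cochainCohomology_iff] at hi
  unfold GermEq
  filter_upwards [eventually_exists_eq_tmul, (cdga 𝔥).eventually_ker_covDeriv_le θ i hi]
    with ω h1 h2
  rw [mem_resonance_one_iff, Set.mem_empty_iff_false, iff_false]
  rintro ⟨hω, hne⟩
  obtain ⟨η, g, hη, hωg⟩ := h1 hω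
  exact hne (h2 η g hη hωg)

end ChevalleyEilenberg

/-! ### Cones over Segre products -/

/-- The scalar ambiguity of a projective point is absorbed into the first factor, which is
unrestricted. -/
theorem mem_cone_segre_univ_iff {E F : Type*} [AddCommGroup E] [Module ℂ E] [AddCommGroup F]
    [Module ℂ F] (T : Set (ℙ ℂ F)) (z : E ⊗[ℂ] F) :
    z ∈ cone (segre Set.univ T) ↔ z = 0 ∨ ∃ (x : E) (y : F) (hy : y ≠ 0), x ≠ 0 ∧
      Projectivization.mk ℂ y hy ∈ T ∧ z = x ⊗ₜ y := by
  refine or_congr_right ⟨?_, ?_⟩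
  · rintro ⟨hz, x, y, hx, hy, hxy, -, hT, h⟩
    obtain ⟨c, hc⟩ := (Projectivization.mk_eq_mk_iff' ℂ _ _ hz hxy).mp h
    refine ⟨c • x, y, hy, fun h0 => hz ?_, hT, ?_⟩
    · rw [← hc, TensorProduct.smul_tmul', h0, TensorProduct.zero_tmul]
    · rw [← hc, TensorProduct.smul_tmul']
  · rintro ⟨x, y, hy, hx, hT, rfl⟩
    have hxy : x ⊗ₜ[ℂ] y ≠ 0 := fun h0 => by
      obtain ⟨f, hf⟩ := Module.Projective.exists_dual_eq_one ℂ hy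
      have h1 := congrArg (CDGA.contractCoeff f E) h0
      rw [CDGA.contractCoeff_tmul, hf, one_smul, map_zero] at h1
      exact hx h1
    exact ⟨hxy, x, y, hx, hy, hxy, trivial, hT, rfl⟩

theorem mk_mem_projZeros_det_iff {𝔤 V : Type*} [LieRing 𝔤] [LieAlgebra ℂ 𝔤] [AddCommGroup V]
    [Module ℂ V] (θ : 𝔤 →ₗ⁅ℂ⁆ Module.End ℂ V) {g : 𝔤} (hg : g ≠ 0) :
    Projectivization.mk ℂ g hg ∈ projZeros (fun g => LinearMap.det (θ g)) ↔
      LinearMap.det (θ g) = 0 := by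
  change (∀ x ∈ (Projectivization.mk ℂ g hg).submodule, LinearMap.det (θ x) = 0) ↔ _
  rw [Projectivization.submodule_mk]
  refine ⟨fun h => h g (Submodule.mem_span_singleton_self g), fun h x hx => ?_⟩
  obtain ⟨c, rfl⟩ := Submodule.mem_span_singleton.mp hx
  rw [map_smul, LinearMap.det_smul, h, mul_zero]

/-! ### Linear maps are analytic -/

theorem LinearMap.analyticAtZero {E F : Type*} [AddCommGroup E] [Module ℂ E]
    [FiniteDimensional ℂ E] [AddCommGroup F] [Module ℂ F] [FiniteDimensional ℂ F]
    (f : E →ₗ[ℂ] F) : AnalyticAtZero f :=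
  (LinearMap.toContinuousLinearMap ((Module.finBasis ℂ F).equivFun.toLinearMap ∘ₗ f ∘ₗ
    (Module.finBasis ℂ E).equivFun.symm.toLinearMap)).analyticAt 0

/-! ### Closed one-forms and the cone over the first cohomology -/

namespace CDGA

variable {A : Type*} [Ring A] [Algebra ℂ A] {𝒜 : ℕ → Submodule ℂ A} [GradedAlgebra 𝒜]
  (D : CDGA 𝒜) (hD : D.IsConnected)

theorem dDeg_h1Incl (x : D.H 1) : D.dDeg 1 (D.h1Incl hD x) = 0 := by
  obtain ⟨z, rfl⟩ := Submodule.Quotient.mk_surjective _ x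
  exact z.2

theorem h1Incl_injective : Function.Injective (D.h1Incl hD) := by
  rw [← LinearMap.ker_eq_bot, eq_bot_iff]
  intro x hx
  obtain ⟨z, rfl⟩ := Submodule.Quotient.mk_surjective _ x
  have hz : z = 0 := Subtype.ext hx
  rw [hz]
  exact Submodule.zero_mem _

theorem exists_h1Incl_eq {η : 𝒜 1} (hη : D.dDeg 1 η = 0) : ∃ x, D.h1Incl hD x = η :=
  ⟨Submodule.Quotient.mk ⟨η, hη⟩, rfl⟩

variable {𝔤 : Type*} [LieRing 𝔤] [LieAlgebra ℂ 𝔤]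

/-- The cone over `ℙ(H¹) × ℙ(W)`, for a cone `W` in `𝔤`, inside `A¹ ⊗ 𝔤`. -/
theorem mem_image_cone_segre_iff {T : Set (ℙ ℂ 𝔤)} {P : 𝔤 → Prop} (hP0 : P 0)
    (hP : ∀ (g : 𝔤) (hg : g ≠ 0), Projectivization.mk ℂ g hg ∈ T ↔ P g) (ω : 𝒜 1 ⊗[ℂ] 𝔤) :
    ω ∈ (D.h1Incl hD).rTensor 𝔤 '' cone (segre Set.univ T) ↔
      ∃ (η : 𝒜 1) (g : 𝔤), D.dDeg 1 η = 0 ∧ ω = η ⊗ₜ g ∧ P g := by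
  constructor
  · rintro ⟨z, hz, rfl⟩
    rcases (mem_cone_segre_univ_iff T z).mp hz with rfl | ⟨x, g, hg, -, hT, rfl⟩
    · exact ⟨0, 0, map_zero _, by rw [map_zero, TensorProduct.zero_tmul], hP0⟩
    · exact ⟨_, g, D.dDeg_h1Incl hD x, LinearMap.rTensor_tmul _ _ _ _, (hP g hg).mp hT⟩
  · rintro ⟨η, g, hη, rfl, hPg⟩
    obtain ⟨x, rfl⟩ := D.exists_h1Incl_eq hD hη
    refine ⟨x ⊗ₜ g, (mem_cone_segre_univ_iff T _).mpr ?_, LinearMap.rTensor_tmul _ _ _ _⟩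
    by_cases hg : g = 0
    · exact Or.inl (by rw [hg, TensorProduct.tmul_zero])
    by_cases hx : x = 0
    · exact Or.inl (by rw [hx, TensorProduct.zero_tmul])
    exact Or.inr ⟨x, g, hg, hx, (hP g hg).mpr hPg, rfl⟩

include hD in
theorem eq_zero_of_subsingleton_H_one (h : Subsingleton (D.H 1)) {η : 𝒜 1}
    (hη : D.dDeg 1 η = 0) : η = 0 := by
  rw [subsingleton_cochainCohomology_iff, D.coboundaries_one_of_isConnected hD] at h
  exact h hη

end CDGA

/-- The embedding `J` and any linear retraction of it are inverse analytic maps between the two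
germs. -/
theorem germIso_of_image {E F : Type*} [AddCommGroup E] [Module ℂ E] [FiniteDimensional ℂ E]
    [AddCommGroup F] [Module ℂ F] [FiniteDimensional ℂ F] (J : F →ₗ[ℂ] E)
    (hJ : Function.Injective J) {X : Set E} {Y : Set F} (hXY : GermEq X (J '' Y))
    (hYX : J '' Y ⊆ X) : GermIso X Y := by
  obtain ⟨p, hp⟩ := J.exists_leftInverse_of_injective (LinearMap.ker_eq_bot.mpr hJ)
  have hpJ : ∀ y, p (J y) = y := LinearMap.congr_fun hp
  refine ⟨p, J, p.analyticAtZero, J.analyticAtZero, map_zero p, map_zero J, ?_,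
    Filter.Eventually.of_forall fun y hy => ⟨hYX ⟨y, hy, rfl⟩, hpJ y⟩⟩
  unfold GermEq at hXY
  filter_upwards [hXY] with x hx hxX
  obtain ⟨y, hy, rfl⟩ := hx.mp hxX
  rw [hpJ]
  exact ⟨hy, rfl⟩

/-! ### The germs of flat connections and of resonance varieties -/

namespace ChevalleyEilenberg

variable {𝔥 : Type*} [LieRing 𝔥] [LieAlgebra ℂ 𝔥] [FiniteDimensional ℂ 𝔥]

theorem germEq_flatConnections :
    GermEq ((cdga 𝔥).flatConnections sl₂)
      (((cdga 𝔥).h1Incl (isConnected 𝔥)).rTensor sl₂ ''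
        cone (segre (Set.univ : Set (ℙ ℂ ((cdga 𝔥).H 1))) (Set.univ : Set (ℙ ℂ sl₂)))) := by
  unfold GermEq
  filter_upwards [eventually_exists_eq_tmul] with ω h
  rw [(cdga 𝔥).mem_image_cone_segre_iff (isConnected 𝔥) (P := fun _ => True) trivial
    fun _ _ => iff_of_true (Set.mem_univ _) trivial]
  constructor
  · intro hω
    obtain ⟨η, g, hη, hωg⟩ := h hω
    exact ⟨η, g, hη, hωg, trivial⟩
  · rintro ⟨η, g, hη, rfl, -⟩
    exact (cdga 𝔥).tmul_mem_flatConnections hη g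

theorem germIso_flatConnections :
    GermIso ((cdga 𝔥).flatConnections sl₂)
      (cone (segre (Set.univ : Set (ℙ ℂ ((cdga 𝔥).H 1))) (Set.univ : Set (ℙ ℂ sl₂)))) := by
  refine germIso_of_image (((cdga 𝔥).h1Incl (isConnected 𝔥)).rTensor sl₂)
    (Module.Flat.rTensor_preserves_injective_linearMap _
      ((cdga 𝔥).h1Incl_injective (isConnected 𝔥))) germEq_flatConnections fun ω hω => ?_
  rw [(cdga 𝔥).mem_image_cone_segre_iff (isConnected 𝔥) (P := fun _ => True) trivial
    fun _ _ => iff_of_true (Set.mem_univ _) trivial] at hω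
  obtain ⟨η, g, hη, rfl, -⟩ := hω
  exact (cdga 𝔥).tmul_mem_flatConnections hη g

theorem germEq_flatConnections_zero (h1 : Subsingleton ((cdga 𝔥).H 1)) :
    GermEq ((cdga 𝔥).flatConnections sl₂) {0} := by
  unfold GermEq
  filter_upwards [eventually_exists_eq_tmul] with ω h
  rw [Set.mem_singleton_iff]
  constructor
  · intro hω
    obtain ⟨η, g, hη, rfl⟩ := h hω
    rw [(cdga 𝔥).eq_zero_of_subsingleton_H_one (isConnected 𝔥) h1 hη, TensorProduct.zero_tmul]
  · rintro rfl
    rw [← TensorProduct.zero_tmul _ (0 : sl₂)]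
    exact (cdga 𝔥).tmul_mem_flatConnections (map_zero _) 0

variable {V : Type*} [AddCommGroup V] [Module ℂ V] [FiniteDimensional ℂ V] [Nontrivial V]
  (θ : sl₂ →ₗ⁅ℂ⁆ Module.End ℂ V)

theorem germEq_resonance_zero (h1 : Subsingleton ((cdga 𝔥).H 1)) (i : ℕ)
    (hi : Nontrivial ((cdga 𝔥).H i)) : GermEq ((cdga 𝔥).resonance θ i 1) {0} := by
  unfold GermEq
  filter_upwards [eventually_mem_resonance_iff θ i hi] with ω h
  rw [h, Set.mem_singleton_iff]
  constructor
  · rintro ⟨η, g, hη, rfl, -⟩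
    rw [(cdga 𝔥).eq_zero_of_subsingleton_H_one (isConnected 𝔥) h1 hη, TensorProduct.zero_tmul]
  · rintro rfl
    exact ⟨0, 0, map_zero _, (TensorProduct.zero_tmul _ _).symm, det_map_zero θ⟩

theorem germEq_resonance (i : ℕ) (hi : Nontrivial ((cdga 𝔥).H i)) :
    GermEq ((cdga 𝔥).resonance θ i 1)
      (((cdga 𝔥).h1Incl (isConnected 𝔥)).rTensor sl₂ ''
        cone (segre (Set.univ : Set (ℙ ℂ ((cdga 𝔥).H 1)))
          (projZeros fun g : sl₂ => LinearMap.det (θ g)))) := by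
  unfold GermEq
  filter_upwards [eventually_mem_resonance_iff θ i hi] with ω h
  rw [h, (cdga 𝔥).mem_image_cone_segre_iff (isConnected 𝔥)
    (P := fun g => LinearMap.det (θ g) = 0) (det_map_zero θ)
    fun _ hg => mk_mem_projZeros_det_iff θ hg]

end ChevalleyEilenberg

theorem theorem4p9 {𝔥 : Type*} [LieRing 𝔥] [LieAlgebra ℂ 𝔥] [FiniteDimensional ℂ 𝔥]
    {V : Type*} [AddCommGroup V] [Module ℂ V] [FiniteDimensional ℂ V] [Nontrivial V]
    (θ : sl₂ →ₗ⁅ℂ⁆ Module.End ℂ V) :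
    -- the case where the first cohomology vanishes
    (Subsingleton ((ChevalleyEilenberg.cdga 𝔥).H 1) →
      GermEq ((ChevalleyEilenberg.cdga 𝔥).flatConnections sl₂) {0} ∧
      ∀ i : ℕ,
        (Subsingleton ((ChevalleyEilenberg.cdga 𝔥).H i) →
          GermEq ((ChevalleyEilenberg.cdga 𝔥).resonance θ i 1) ∅) ∧
        (Nontrivial ((ChevalleyEilenberg.cdga 𝔥).H i) →
          GermEq ((ChevalleyEilenberg.cdga 𝔥).resonance θ i 1) {0})) ∧
    -- the case where the first cohomology does not vanish
    (Nontrivial ((ChevalleyEilenberg.cdga 𝔥).H 1) →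
      GermIso ((ChevalleyEilenberg.cdga 𝔥).flatConnections sl₂)
        (cone (segre (Set.univ : Set (ℙ ℂ ((ChevalleyEilenberg.cdga 𝔥).H 1)))
          (Set.univ : Set (ℙ ℂ sl₂)))) ∧
      GermEq ((ChevalleyEilenberg.cdga 𝔥).flatConnections sl₂)
        (((ChevalleyEilenberg.cdga 𝔥).h1Incl (ChevalleyEilenberg.isConnected 𝔥)).rTensor sl₂ ''
          cone (segre (Set.univ : Set (ℙ ℂ ((ChevalleyEilenberg.cdga 𝔥).H 1)))
            (Set.univ : Set (ℙ ℂ sl₂)))) ∧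
      ∀ i : ℕ,
        (Subsingleton ((ChevalleyEilenberg.cdga 𝔥).H i) →
          GermEq ((ChevalleyEilenberg.cdga 𝔥).resonance θ i 1) ∅) ∧
        (Nontrivial ((ChevalleyEilenberg.cdga 𝔥).H i) →
          GermEq ((ChevalleyEilenberg.cdga 𝔥).resonance θ i 1)
            (((ChevalleyEilenberg.cdga 𝔥).h1Incl (ChevalleyEilenberg.isConnected 𝔥)).rTensor sl₂ ''
              cone (segre (Set.univ : Set (ℙ ℂ ((ChevalleyEilenberg.cdga 𝔥).H 1)))
                (projZeros fun g : sl₂ => LinearMap.det (θ g)))))) := by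
  open ChevalleyEilenberg in
  exact ⟨fun h1 => ⟨germEq_flatConnections_zero h1, fun i =>
      ⟨germEq_resonance_empty θ i, germEq_resonance_zero θ h1 i⟩⟩,
    fun _ => ⟨germIso_flatConnections, germEq_flatConnections, fun i =>
      ⟨germEq_resonance_empty θ i, germEq_resonance θ i⟩⟩⟩
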